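/- Let $M$ be a compact orientable $C^\infty$ surface without boundary, equipped with a $C^\infty$ Riemannian metric, and fix an orientation of $M$. Let $\Phi$ be the geodesic flow on the unit tangent bundle $SM$, and suppose that $\Phi$ is equicontinuous: for a metric $d$ inducing the topology of $SM$ (equivalently, for every such metric), for every $\varepsilon>0$ there is $\delta>0$ such that $d(v,w)<\delta$ implies $d(\Phi_t(v),\Phi_t(w))<\varepsilon$ for all $t\in\mathbb R$. Let $\gamma:\mathbb R\to M$ be a simple closed geodesic, parametrized by arc length, of length $\ell$. Let $A\subset SM$ be the set of all unit vectors that are based at a point of $\gamma$ and point strictly to the left of $\gamma$. For $v\in A$ based at $\gamma(t)$, let $\theta(v)\in(0,1)$ be the angle between $\dot\gamma(t)$ and $v$ divided by $\pi$, and put $$\iota(v)=\bigl(\sin(\pi\theta(v))\cos(2\pi t/\ell),\ \sin(\pi\theta(v))\sin(2\pi t/\ell),\ \cos(\pi\theta(v))\bigr)\in S^2 .$$ Then: 1. $\iota$ is a homeomorphism of $A$ onto $S^2\setminus\{(0,0,1),(0,0,-1)\}$; thus $A$ is an open annulus and $S^2$ is its two-point compactification. 2. For every $v\in A$ there is a least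 time $\tau(v)>0$ with $\Phi_{\tau(v)}(v)\in A$, so the geodesic return map $F:A\to A$, $F(v)=\Phi_{\tau(v)}(v)$, is defined. 3. Under $\iota$, the map $F$ extends to a homeomorphism $\hat F:S^2\to S^2$ (that is, $\hat F\circ\iota=\iota\circ F$) that fixes the two points $(0,0,\pm1)$. 4. $\hat F$ is recurrent: there is a sequence of natural numbers $n_k\to\infty$ such that $\sup_{x\in S^2} d(\hat F^{n_k}(x),x)\to 0$ as $k\to\infty$, where $d$ is the Euclidean distance on $S^2$. -/

import Mathlib

open Set Filter Topology Bundle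
open scoped Manifold ContDiff

noncomputable section

-- the standard charted space structure of a model space is to be preferred over that of `TopCat.of`
attribute [local instance 2000] chartedSpaceSelf

namespace GeodesicReturn

/-- An equicontinuous flow: with respect to a metric inducing the topology of `X`, for every
`ε > 0` there is `δ > 0` such that `δ`-close points stay `ε`-close for all times.
(On a compact space this does not depend on the metric.) -/
def IsEquicontinuousFlow {X : Type*} [inst : TopologicalSpace X] (Φ : Flow ℝ X) : Prop :=
  ∃ m : MetricSpace X, m.toPseudoMetricSpace.toUniformSpace.toTopologicalSpace = inst ∧
    ∀ ε > 0, ∃ δ > 0, ∀ x y : X, m.dist x y < δ → ∀ t : ℝ, m.dist (Φ t x) (Φ t y) < ε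

/-- A continuous self-map `f` of a metric space is recurrent if there are `n_k → ∞` with
`sup_x d(f^{n_k}(x), x) → 0`; the supremum is taken in `[0, ∞]`. -/
def IsRecurrent {X : Type*} [MetricSpace X] (f : X → X) : Prop :=
  Continuous f ∧ ∃ n : ℕ → ℕ, Tendsto n atTop atTop ∧
    Tendsto (fun k => ⨆ x, edist (f^[n k] x) x) atTop (𝓝 0)

/-- The Euclidean plane, on which surfaces are modelled. -/
abbrev Plane : Type := EuclideanSpace ℝ (Fin 2)

/-- The round sphere `S²`. -/
abbrev S2 : Type := Metric.sphere (0 : EuclideanSpace ℝ (Fin 3)) 1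

section Surface

variable {M : Type*} [TopologicalSpace M] [ChartedSpace Plane M]

/-- An oriented atlas: smooth charts covering `M` whose transition maps have positive Jacobian
determinant. A surface is orientable if and only if it has one. -/
structure IsOrientedAtlas [IsManifold (𝓡 2) ∞ M] (𝒜 : Set (OpenPartialHomeomorph M Plane)) :
    Prop where
  subset_maximalAtlas : 𝒜 ⊆ IsManifold.maximalAtlas (𝓡 2) ∞ M
  covers : ∀ x : M, ∃ e ∈ 𝒜, x ∈ e.source
  det_pos : ∀ e ∈ 𝒜, ∀ e' ∈ 𝒜, ∀ x ∈ e.source ∩ e'.source,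
    0 < (fderiv ℝ (e' ∘ e.symm) (e x)).det

/-- The pair `(u, w)` of tangent vectors at `x` is a positively oriented basis. -/
def IsPositivePair [IsManifold (𝓡 2) ∞ M] (𝒜 : Set (OpenPartialHomeomorph M Plane)) (x : M)
    (u w : TangentSpace (𝓡 2) x) : Prop :=
  ∃ e ∈ 𝒜, x ∈ e.source ∧
    let a : Plane := mfderiv (𝓡 2) (𝓡 2) e x u
    let b : Plane := mfderiv (𝓡 2) (𝓡 2) e x w
    0 < a 0 * b 1 - a 1 * b 0

/-- The velocity vector of a curve. -/
def velocity (γ : ℝ → M) (t : ℝ) : TangentSpace (𝓡 2) (γ t) :=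
  mfderiv 𝓘(ℝ, ℝ) (𝓡 2) γ t (1 : ℝ)

variable [RiemannianBundle (fun x : M => TangentSpace (𝓡 2) x)]

/-- The Riemannian metric in the chart at `p`: the value at the coordinate point `y` on the
coordinate vectors `u`, `w`. -/
def chartMetric (p : M) (y u w : Plane) : ℝ :=
  let φ : Plane → M := (extChartAt (𝓡 2) p).symm
  inner ℝ (mfderiv (𝓡 2) (𝓡 2) φ y u : TangentSpace (𝓡 2) (φ y))
    (mfderiv (𝓡 2) (𝓡 2) φ y w : TangentSpace (𝓡 2) (φ y))

/-- The Christoffel symbols of the first kind in the chart at `p`: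
`Γ(u, v; w) = (∂_u g(v, w) + ∂_v g(u, w) - ∂_w g(u, v)) / 2`. -/
def christoffel (p : M) (y u v w : Plane) : ℝ :=
  (fderiv ℝ (fun z => chartMetric p z v w) y u + fderiv ℝ (fun z => chartMetric p z u w) y v
    - fderiv ℝ (fun z => chartMetric p z u v) y w) / 2

/-- A geodesic parametrized by arc length and defined for all times: a smooth curve of unit speed
which in charts satisfies the geodesic equation `c'' + Γ(c', c') = 0`, written with the index
lowered by the metric. -/
structure IsGeodesic [IsManifold (𝓡 2) ∞ M] (γ : ℝ → M) : Prop where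
  smooth : ContMDiff 𝓘(ℝ, ℝ) (𝓡 2) ∞ γ
  unit_speed : ∀ t, ‖velocity γ t‖ = 1
  equation : ∀ (p : M) (t : ℝ), γ t ∈ (chartAt Plane p).source →
    let c : ℝ → Plane := fun s => extChartAt (𝓡 2) p (γ s)
    ∀ w : Plane, chartMetric p (c t) (deriv (deriv c) t) w
      + christoffel p (c t) (deriv c t) (deriv c t) w = 0

/-- A simple closed geodesic of length `ℓ`. -/
structure IsSimpleClosedGeodesic [IsManifold (𝓡 2) ∞ M] (γ : ℝ → M) (ℓ : ℝ) : Prop where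
  geodesic : IsGeodesic γ
  length_pos : 0 < ℓ
  periodic : Function.Periodic γ ℓ
  simple : InjOn γ (Ico 0 ℓ)

variable (M) in
/-- The unit tangent bundle `SM`, with the topology induced from `TM`. -/
abbrev UnitTangent [IsManifold (𝓡 2) ∞ M] : Type _ :=
  {v : TangentBundle (𝓡 2) M // ‖v.2‖ = 1}

/-- `Φ` is the geodesic flow on `SM`: each orbit consists of the velocity vectors of the geodesic
to which its initial point is tangent. -/
def IsGeodesicFlow [IsManifold (𝓡 2) ∞ M] (Φ : Flow ℝ (UnitTangent M)) : Prop :=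
  ∀ v : UnitTangent M, IsGeodesic (fun t => (Φ t v).1.proj) ∧
    ∀ t, (Φ t v).1 = ⟨(Φ t v).1.proj, velocity (fun s => (Φ s v).1.proj) t⟩

/-- `v` is a unit vector `w` based at `γ t` and pointing strictly to the left of `γ`. -/
def IsLeftVector [IsManifold (𝓡 2) ∞ M] (𝒜 : Set (OpenPartialHomeomorph M Plane)) (γ : ℝ → M)
    (v : UnitTangent M) (t : ℝ) (w : TangentSpace (𝓡 2) (γ t)) : Prop :=
  v.1 = ⟨γ t, w⟩ ∧ IsPositivePair 𝒜 (γ t) (velocity γ t) w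

/-- The annulus of the unit vectors along `γ` pointing strictly to the left of `γ`. -/
def annulus [IsManifold (𝓡 2) ∞ M] (𝒜 : Set (OpenPartialHomeomorph M Plane)) (γ : ℝ → M) :
    Set (UnitTangent M) :=
  {v | ∃ (t : ℝ) (w : TangentSpace (𝓡 2) (γ t)), IsLeftVector 𝒜 γ v t w}

/-- The point of `S²` with colatitude `α` and longitude `β`. -/
def spherePoint (α β : ℝ) : S2 :=
  ⟨!₂[Real.sin α * Real.cos β, Real.sin α * Real.sin β, Real.cos α], by
    rw [mem_sphere_zero_iff_norm, EuclideanSpace.norm_eq, Real.sqrt_eq_one]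
    simp only [Fin.sum_univ_three, Real.norm_eq_abs, sq_abs]
    simp only [Matrix.cons_val]
    linear_combination (Real.sin α) ^ 2 * Real.sin_sq_add_cos_sq β + Real.sin_sq_add_cos_sq α⟩

/-- The pole `θ = 0` of `S²`. -/
def northPole : S2 := spherePoint 0 0

/-- The pole `θ = 1` of `S²`. -/
def southPole : S2 := spherePoint Real.pi 0

/-- The identification of the annulus with `S²` minus the poles: the vector at `γ t` which makes
the angle `π θ`, `0 < θ < 1`, with the velocity of `γ` goes to the point of colatitude `π θ` and
longitude `2 π t / ℓ`. (The parameter `t` is unique modulo `ℓ`.) -/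
def annulusToSphere [IsManifold (𝓡 2) ∞ M] (𝒜 : Set (OpenPartialHomeomorph M Plane)) (γ : ℝ → M)
    (ℓ : ℝ) (v : annulus 𝒜 γ) : S2 :=
  let t : ℝ := v.2.choose
  let w : TangentSpace (𝓡 2) (γ t) := v.2.choose_spec.choose
  spherePoint (InnerProductGeometry.angle (velocity γ t) w) (2 * Real.pi * t / ℓ)

/-- `τ` is the first positive time at which the orbit of `v` is in `A`. -/
def IsFirstReturnTime {X : Type*} [TopologicalSpace X] (Φ : Flow ℝ X) (A : Set X) (v : X)
    (τ : ℝ) : Prop :=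
  IsLeast {s : ℝ | 0 < s ∧ Φ s v ∈ A} τ

/-- `F` is the first return map of the flow `Φ` to the set `A`: every point of `A` has a first
return time, and `F` moves the point along its orbit for this time. -/
def IsFirstReturnMap {X : Type*} [TopologicalSpace X] (Φ : Flow ℝ X) (A : Set X) (F : A → A) :
    Prop :=
  ∀ v : A, ∃ τ : ℝ, IsFirstReturnTime Φ A v τ ∧ (F v : X) = Φ τ v

end Surface

end GeodesicReturn

end

open Set Filter Topology Bundle
open scoped Manifold ContDiff

noncomputable section

set_option linter.unusedSectionVars false

namespace GeodesicReturn

/-! Let `B` be the closed annulus, that is `A` together with the two circles of vectors tangent to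
`γ`, and let `p : B → S²` extend `ι` by collapsing each circle to a pole. By uniqueness of geodesics
each circle is invariant under the flow, and an orbit that meets `A` can meet `B` only in `A`. So
`A`, although not closed, has closed sets of return times.

The flow crosses `A` transversally: in a chart, `γ` is locally the zero set of a function `f`, and
the derivative of `f` along a geodesic starting at `v ∈ A` is the oriented area of the velocity of
`γ` and `v`, which is positive on the left side. Hence near `A` an orbit meets `A` exactly once
within a short time.

Equicontinuity on the compact space `SM` gives arbitrarily late times `t` at which `Φ t` is
uniformly close to the identity (`exists_uniformly_recurrent_time`). Each point of `A` is then
brought back near itself, so it returns; transversality makes the return time continuous, and the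
reversed flow gives the inverse of the return map. The extension to the poles is continuous because
an orbit starting near one of the invariant circles stays near it (`pole_stable`).

For recurrence, take a compact connected band avoiding the poles and a late time `t` with `Φ t`
close to the identity. Every point of the band has exactly one return at a time close to `t`. The
index of this return is locally constant, hence one number `n` on the whole band, and the `n`-th
iterate is close to the identity there (`exists_iterate_close`). Near the poles, stability bounds
the displacement under every iterate.

The argument is carried out for an abstract `PolarSection`; the differential geometry serves to
verify its axioms in `exists_polarSection`. -/

/-- An equicontinuous flow on a compact metric space comes back uniformly close to the identity
at arbitrarily late times. -/
theorem exists_uniformly_recurrent_time {X : Type*} [MetricSpace X] [CompactSpace X]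
    (Φ : Flow ℝ X)
    (equi : ∀ ε > 0, ∃ δ > 0, ∀ x y : X, dist x y < δ → ∀ t : ℝ, dist (Φ t x) (Φ t y) < ε)
    {ε : ℝ} (hε : 0 < ε) {R : ℝ} (hR : 0 < R) : ∃ t ≥ R, ∀ v, dist (Φ t v) v < ε := by
  obtain ⟨δ, hδ, H⟩ := equi (ε / 3) (by positivity)
  obtain ⟨s, -, hs, hcov⟩ := Metric.finite_approx_of_totallyBounded
    (isCompact_univ (X := X)).totallyBounded δ hδ
  have := hs.fintype
  -- The time-`kR` maps, restricted to a finite `δ`-net, are points of a compact finite power of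
  -- `X`. Two late terms of a convergent subsequence are close on the net, hence close everywhere by
  -- equicontinuity, and their times differ by at least `R`.
  obtain ⟨a, φ, hφ, ha⟩ := CompactSpace.tendsto_subseq
    (fun (k : ℕ) (x : s) => Φ (k * R) x.1)
  have hc := Metric.cauchySeq_iff'.1 ha.cauchySeq (ε / 3) (by positivity)
  obtain ⟨n, hn⟩ := hc
  have h1 := hn (n + 1) (Nat.le_succ n)
  rw [dist_pi_lt_iff (by positivity)] at h1
  have hlt : φ n < φ (n + 1) := hφ (Nat.lt_succ_self n)
  have key : ∀ x, dist (Φ (φ (n + 1) * R) x) (Φ (φ n * R) x) < ε := by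
    intro x
    obtain ⟨y, hy, hxy⟩ := mem_iUnion₂.1 (hcov (mem_univ x))
    have h2 := H x y hxy (φ (n + 1) * R)
    have h3 := H x y hxy (φ n * R)
    have h4 := h1 ⟨y, hy⟩
    simp only [Function.comp] at h4
    rw [dist_comm] at h3
    have h5 := dist_triangle4 (Φ (φ (n + 1) * R) x) (Φ (φ (n + 1) * R) y) (Φ (φ n * R) y)
      (Φ (φ n * R) x)
    linarith
  refine ⟨(φ (n + 1) : ℝ) * R - φ n * R, ?_, fun v => ?_⟩
  · have : (φ n : ℝ) + 1 ≤ φ (n + 1) := by exact_mod_cast hlt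
    nlinarith
  -- Flowing back by the earlier of the two times turns closeness of two time maps into closeness of
  -- one to the identity.
  · have := key (Φ (-(φ n * R)) v)
    rw [← Φ.map_add, ← Φ.map_add] at this
    simpa [sub_eq_add_neg] using this

/-! ### Abstract sections with two invariant poles -/

/-- A section `A` of an equicontinuous flow which is a punctured sphere-like space: the map `p`
identifies `A` with `Y` minus two poles, and collapses two invariant sets to the poles. -/
structure PolarSection {X Y : Type*} [MetricSpace X] [CompactSpace X] [MetricSpace Y]
    (Φ : Flow ℝ X) (A B : Set X) (p : X → Y) (N S : Y) : Prop where
  equi : ∀ ε > 0, ∃ δ > 0, ∀ x y : X, dist x y < δ → ∀ t : ℝ, dist (Φ t x) (Φ t y) < ε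
  isClosed : IsClosed B
  cont : ContinuousOn p B
  surj : ∀ y, ∃ v ∈ B, p v = y
  mem_iff : ∀ v, v ∈ A ↔ v ∈ B ∧ p v ≠ N ∧ p v ≠ S
  inj : InjOn p A
  ne : N ≠ S
  north : ∀ v ∈ B, p v = N → ∀ t, Φ t v ∈ B ∧ p (Φ t v) = N
  south : ∀ v ∈ B, p v = S → ∀ t, Φ t v ∈ B ∧ p (Φ t v) = S
  -- `hit` and `sep` are all that is needed of transversality: existence and uniqueness of a
  -- crossing within a short time, locally uniformly in the starting point.
  hit : ∀ v ∈ A, ∀ ε > 0, ∀ᶠ u in 𝓝 v, ∃ s, |s| < ε ∧ Φ s u ∈ A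
  sep : ∀ v ∈ A, ∃ ε > 0, ∀ᶠ u in 𝓝 v, ∀ s s', |s| < ε → |s'| < ε → Φ s u ∈ A → Φ s' u ∈ A →
    s = s'
  -- This is where connectedness of the section enters: it lets an integer-valued continuous
  -- function be constant away from the poles.
  core : ∀ U ∈ 𝓝 N, ∀ V ∈ 𝓝 S, ∃ K : Set Y, IsClosed K ∧ IsPreconnected K ∧ K.Nonempty ∧
    N ∉ K ∧ S ∉ K ∧ ∀ y, y ∈ K ∨ y ∈ U ∨ y ∈ V

namespace PolarSection

variable {X Y : Type*} [MetricSpace X] [CompactSpace X] [MetricSpace Y]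
  {Φ : Flow ℝ X} {A B : Set X} {p : X → Y} {N S : Y}

/-- All axioms are symmetric in time. The return map of the reversed flow will be the inverse of the
return map. -/
theorem reverse (h : PolarSection Φ A B p N S) : PolarSection Φ.reverse A B p N S where
  equi ε hε := by
    obtain ⟨δ, hδ, H⟩ := h.equi ε hε
    exact ⟨δ, hδ, fun x y hxy t => H x y hxy (-t)⟩
  isClosed := h.isClosed
  cont := h.cont
  surj := h.surj
  mem_iff := h.mem_iff
  inj := h.inj
  ne := h.ne
  north v hv hp t := h.north v hv hp (-t)
  south v hv hp t := h.south v hv hp (-t)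
  hit v hv ε hε := by
    filter_upwards [h.hit v hv ε hε] with u ⟨s, hs, hsA⟩
    exact ⟨-s, by simpa using hs, by simpa using hsA⟩
  sep v hv := by
    obtain ⟨ε, hε, H⟩ := h.sep v hv
    refine ⟨ε, hε, ?_⟩
    filter_upwards [H] with u hu s s' hs hs' hA hA'
    have := hu (-s) (-s') (by simpa using hs) (by simpa using hs') hA hA'
    linarith
  core := h.core

/-- The poles play symmetric roles, so every argument near a pole is made only for `N`. -/
theorem swap (h : PolarSection Φ A B p N S) : PolarSection Φ A B p S N where
  equi := h.equi
  isClosed := h.isClosed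
  cont := h.cont
  surj := h.surj
  mem_iff v := by rw [h.mem_iff]; tauto
  inj := h.inj
  ne := h.ne.symm
  north := h.south
  south := h.north
  hit := h.hit
  sep := h.sep
  core U hU V hV := by
    obtain ⟨K, h1, h2, h3, h4, h5, h6⟩ := h.core V hV U hU
    exact ⟨K, h1, h2, h3, h5, h4, fun y => by have := h6 y; tauto⟩

theorem subset (h : PolarSection Φ A B p N S) : A ⊆ B := fun v hv => ((h.mem_iff v).1 hv).1

/-- A point of `B` outside `A` lies over a pole, and so does its whole orbit; flowing back would put
`v` itself over a pole. This allows the closed set `B` to replace `A` along orbits that start in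
`A`. -/
theorem mem_of_mem_closed (h : PolarSection Φ A B p N S) {v : X} (hv : v ∈ A) {t : ℝ}
    (ht : Φ t v ∈ B) : Φ t v ∈ A := by
  rw [h.mem_iff] at hv
  refine (h.mem_iff _).2 ⟨ht, fun hN => hv.2.1 ?_, fun hS => hv.2.2 ?_⟩
  · simpa [← Φ.map_add] using (h.north _ ht hN (-t)).2
  · simpa [← Φ.map_add] using (h.south _ ht hS (-t)).2

/-! ### First return time and return map -/

theorem exists_return (h : PolarSection Φ A B p N S) {v : X} (hv : v ∈ A) (R : ℝ) :
    ∃ s > R, Φ s v ∈ A := by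
  obtain ⟨ε, hε, H⟩ := Metric.eventually_nhds_iff.1 (h.hit v hv 1 one_pos)
  -- The summand `1` makes up for the correction `|s| < 1` needed to land on the section.
  obtain ⟨t, ht, H'⟩ := exists_uniformly_recurrent_time Φ h.equi hε
    (R := |R| + 1) (by positivity)
  obtain ⟨s, hs, hsA⟩ := H (H' v)
  refine ⟨s + t, ?_, by rwa [Φ.map_add]⟩
  have := (abs_lt.1 hs).1
  have := le_abs_self R
  linarith

/-- Separation excludes returns before some `ε`, and beyond `ε` returning to `A` is the same as
returning to the closed set `B`. So the set of return times is closed and has a least element. -/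
theorem exists_firstReturnTime (h : PolarSection Φ A B p N S) {v : X} (hv : v ∈ A) :
    ∃ τ, IsFirstReturnTime Φ A v τ := by
  obtain ⟨ε, hε, H⟩ := h.sep v hv
  have hv' := H.self_of_nhds
  have heq : {s : ℝ | 0 < s ∧ Φ s v ∈ A} = Ici ε ∩ (fun s => Φ s v) ⁻¹' B := by
    ext s
    constructor
    · rintro ⟨hs, hsA⟩
      refine ⟨?_, h.subset hsA⟩
      by_contra hlt
      simp only [mem_Ici, not_le] at hlt
      have := hv' s 0 (by rwa [abs_of_pos hs]) (by simpa using hε) hsA (by simpa using hv)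
      exact hs.ne' this
    · rintro ⟨hs, hsB⟩
      exact ⟨hε.trans_le hs, h.mem_of_mem_closed hv hsB⟩
  have hcl : IsClosed {s : ℝ | 0 < s ∧ Φ s v ∈ A} := by
    rw [heq]
    exact isClosed_Ici.inter (h.isClosed.preimage (Φ.continuous continuous_id continuous_const))
  obtain ⟨s, hs, hsA⟩ := h.exists_return hv 0
  exact ⟨_, hcl.isLeast_csInf ⟨s, hs, hsA⟩ ⟨0, fun x hx => hx.1.le⟩⟩

/-- The first return time to the section. -/
def returnTime (h : PolarSection Φ A B p N S) (v : A) : ℝ :=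
  (h.exists_firstReturnTime v.2).choose

theorem returnTime_spec (h : PolarSection Φ A B p N S) (v : A) :
    IsFirstReturnTime Φ A v (h.returnTime v) :=
  (h.exists_firstReturnTime v.2).choose_spec

theorem returnTime_pos (h : PolarSection Φ A B p N S) (v : A) : 0 < h.returnTime v :=
  (h.returnTime_spec v).1.1

/-- The first return map to the section. -/
def returnMap (h : PolarSection Φ A B p N S) (v : A) : A :=
  ⟨Φ (h.returnTime v) v, (h.returnTime_spec v).1.2⟩

/-- Lower semicontinuity: there is no return up to a time `a` below the return time, and by
compactness of `[0, a]` this persists for nearby points, with `sep` handling times near `0` and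
closedness of `B` the others. Upper semicontinuity: by `hit`, nearby orbits cross the section at
nearly the same time. -/
theorem continuous_returnTime (h : PolarSection Φ A B p N S) : Continuous h.returnTime := by
  have hΦ : Continuous fun q : ℝ × X => Φ q.1 q.2 := Φ.continuous continuous_fst continuous_snd
  rw [continuous_iff_continuousAt]
  intro v
  have hpos := h.returnTime_pos v
  rw [ContinuousAt, tendsto_order]
  constructor
  · intro a ha
    have key : ∀ r ∈ Icc 0 a, ∀ᶠ q : X × ℝ in 𝓝 ((v : X), r),
        q.1 ∈ A → 0 < q.2 → Φ q.2 q.1 ∉ A := by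
      intro r hr
      rcases hr.1.eq_or_lt with rfl | hr0
      · obtain ⟨ε, hε, H⟩ := h.sep v v.2
        rw [nhds_prod_eq]
        filter_upwards [H.prod_mk (Metric.ball_mem_nhds (0 : ℝ) hε)] with q hq hqA hq0 hqA'
        have h2 : |q.2| < ε := by simpa using hq.2
        exact hq0.ne' (hq.1 q.2 0 h2 (by simpa using hε) hqA' (by simpa using hqA))
      · have hB : Φ r v ∉ B := fun hB =>
          absurd ((h.returnTime_spec v).2 ⟨hr0, h.mem_of_mem_closed v.2 hB⟩) (by linarith [hr.2])
        have hc : ContinuousAt (fun q : X × ℝ => Φ q.2 q.1) ((v : X), r) :=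
          (hΦ.comp continuous_swap).continuousAt
        filter_upwards [hc.preimage_mem_nhds (h.isClosed.isOpen_compl.mem_nhds hB)] with q hq _ _ hA
        exact hq (h.subset hA)
    have h2 := isCompact_Icc.eventually_forall_of_forall_eventually (x₀ := (v : X))
      (P := fun u r => u ∈ A → 0 < r → Φ r u ∉ A) key
    filter_upwards [continuous_subtype_val.continuousAt.eventually h2] with u hu
    by_contra hle
    exact hu _ ⟨(h.returnTime_pos u).le, not_lt.1 hle⟩ u.2 (h.returnTime_pos u)
      (h.returnTime_spec u).1.2
  · intro a ha
    -- The second term of the minimum keeps the time of the nearby crossing positive.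
    have h1 := h.hit _ (h.returnTime_spec v).1.2 (min (a - h.returnTime v) (h.returnTime v))
      (lt_min (by linarith) hpos)
    have hc : ContinuousAt (fun u : A => Φ (h.returnTime v) u) v :=
      (Φ.continuous continuous_const continuous_subtype_val).continuousAt
    filter_upwards [hc.eventually h1] with u ⟨s, hs, hsA⟩
    rw [lt_min_iff, abs_lt, abs_lt] at hs
    rw [← Φ.map_add] at hsA
    have := (h.returnTime_spec u).2 ⟨by linarith [hs.2.1], hsA⟩
    linarith [hs.1.2]

theorem continuous_returnMap (h : PolarSection Φ A B p N S) : Continuous h.returnMap :=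
  (Φ.continuous h.continuous_returnTime continuous_subtype_val).subtype_mk _

/-- Going backwards from the return point, an earlier hit would be a return of `v` strictly before
its first one; hence both return times agree. -/
theorem reverse_returnMap_returnMap (h : PolarSection Φ A B p N S) (v : A) :
    h.reverse.returnMap (h.returnMap v) = v := by
  have h1 := h.returnTime_spec v
  have h2 := h.reverse.returnTime_spec (h.returnMap v)
  have heq : ∀ s, Φ.reverse s (h.returnMap v : X) = Φ (-s + h.returnTime v) v := fun s => by
    rw [Φ.map_add]; rfl
  have h3 : h.reverse.returnTime (h.returnMap v) = h.returnTime v := by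
    apply le_antisymm
    · exact h2.2 ⟨h1.1.1, by rw [heq]; simp⟩
    · by_contra! hlt
      have := h1.2 ⟨by linarith, heq _ ▸ h2.1.2⟩
      linarith [h2.1.1]
  apply Subtype.ext
  change Φ.reverse _ _ = _
  rw [heq, h3]
  simp

theorem returnMap_reverse_returnMap (h : PolarSection Φ A B p N S) (v : A) :
    h.returnMap (h.reverse.returnMap v) = v := by
  have h1 := h.reverse.returnTime_spec v
  have h2 := h.returnTime_spec (h.reverse.returnMap v)
  have heq : ∀ s, Φ s (h.reverse.returnMap v : X) = Φ.reverse (-s + h.reverse.returnTime v) v :=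
    fun s => by rw [Φ.reverse.map_add]; simp; rfl
  have h3 : h.returnTime (h.reverse.returnMap v) = h.reverse.returnTime v := by
    apply le_antisymm
    · exact h2.2 ⟨h1.1.1, by rw [heq]; simp⟩
    · by_contra! hlt
      have := h1.2 ⟨by linarith, heq _ ▸ h2.1.2⟩
      linarith [h2.1.1]
  apply Subtype.ext
  change Φ _ _ = _
  rw [heq, h3]
  simp

/-! ### Stability of the poles and extension of the return map -/

/-- Orbits starting close to the invariant set over a pole stay close to it. -/
theorem pole_stable (h : PolarSection Φ A B p N S) {U : Set Y} (hU : U ∈ 𝓝 N) :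
    ∃ V ∈ 𝓝 N, ∀ v ∈ B, p v ∈ V → ∀ t, Φ t v ∈ B → p (Φ t v) ∈ U := by
  obtain ⟨U', hU'U, hU'o, hNU'⟩ := mem_nhds_iff.1 hU
  obtain ⟨W, hWo, hW⟩ := (continuousOn_iff'.1 h.cont) U' hU'o
  have hΓ : IsClosed (B ∩ p ⁻¹' {N}) := h.cont.preimage_isClosed_of_isClosed h.isClosed
    isClosed_singleton
  have hsub : B ∩ p ⁻¹' {N} ⊆ W := fun v hv => by
    have : v ∈ p ⁻¹' U' ∩ B := ⟨by simpa [show p v = N from hv.2] using hNU', hv.1⟩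
    rw [hW] at this
    exact this.1
  obtain ⟨ε, hε, hεW⟩ := hΓ.isCompact.exists_thickening_subset_open hWo hsub
  obtain ⟨δ, hδ, H⟩ := h.equi ε hε
  -- The points of `B` far from the polar fibre have compact image missing `N`. The complement of
  -- this image is the required neighbourhood: all of its preimages in `B` are `δ`-close to the
  -- fibre.
  have hc : IsClosed (p '' (B \ Metric.thickening δ (B ∩ p ⁻¹' {N}))) :=
    ((h.isClosed.sdiff Metric.isOpen_thickening).isCompact.image_of_continuousOn
      (h.cont.mono sdiff_subset)).isClosed
  refine ⟨_, hc.isOpen_compl.mem_nhds ?_, ?_⟩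
  · rintro ⟨v, hv, hvN⟩
    exact hv.2 (Metric.self_subset_thickening hδ _ ⟨hv.1, hvN⟩)
  · intro v hv hpv t ht
    have hthick : v ∈ Metric.thickening δ (B ∩ p ⁻¹' {N}) := by
      by_contra hno
      exact hpv ⟨v, ⟨hv, hno⟩, rfl⟩
    obtain ⟨g, hg, hvg⟩ := Metric.mem_thickening_iff.1 hthick
    have h1 := H v g hvg t
    -- The comparison point moves inside the invariant fibre, so staying close to it means staying
    -- close to the fibre.
    have h2 := h.north g hg.1 hg.2 t
    have h3 : Φ t v ∈ W := hεW (Metric.mem_thickening_iff.2 ⟨_, h2, h1⟩)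
    have h4 : Φ t v ∈ p ⁻¹' U' ∩ B := by rw [hW]; exact ⟨h3, ht⟩
    exact hU'U h4.1

/-- The projection restricted to the section. -/
theorem isOpenEmbedding (h : PolarSection Φ A B p N S) :
    IsOpenEmbedding (fun v : A => p v) ∧ range (fun v : A => p v) = {N, S}ᶜ := by
  have hr : range (fun v : A => p v) = {N, S}ᶜ := by
    ext y
    constructor
    · rintro ⟨v, rfl⟩
      have := (h.mem_iff v).1 v.2
      simp [this.2.1, this.2.2]
    · intro hy
      simp only [mem_compl_iff, mem_insert_iff, mem_singleton_iff, not_or] at hy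
      obtain ⟨v, hv, rfl⟩ := h.surj y
      exact ⟨⟨v, (h.mem_iff v).2 ⟨hv, hy.1, hy.2⟩⟩, rfl⟩
  refine ⟨.of_continuous_injective_isOpenMap
    (continuousOn_iff_continuous_domRestrict.1 (h.cont.mono h.subset))
    (fun v w hvw => Subtype.ext (h.inj v.2 w.2 hvw)) fun O hO => ?_, hr⟩
  obtain ⟨W, hW, rfl⟩ := isOpen_induced_iff.1 hO
  have hcl : IsClosed (p '' (B \ W)) := ((h.isClosed.sdiff hW).isCompact.image_of_continuousOn
    (h.cont.mono sdiff_subset)).isClosed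
  -- Outside `A` the map `p` takes only polar values on `B`, and on `A` it is injective. So images
  -- of relatively open sets are complements of compact images, with the poles removed.
  have : (fun v : A => p v) '' (Subtype.val ⁻¹' W) = (p '' (B \ W))ᶜ ∩ {N, S}ᶜ := by
    ext y
    constructor
    · rintro ⟨v, hv, rfl⟩
      refine ⟨?_, hr ▸ mem_range_self v⟩
      rintro ⟨w, hw, hwv⟩
      have hwA : w ∈ A := by
        have := (h.mem_iff v).1 v.2
        exact (h.mem_iff w).2 ⟨hw.1, by rw [hwv]; exact this.2⟩
      exact hw.2 (h.inj hwA v.2 hwv ▸ hv)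
    · rintro ⟨hy, hy'⟩
      rw [← hr] at hy'
      obtain ⟨v, rfl⟩ := hy'
      exact ⟨v, by_contra fun hv => hy ⟨v, ⟨h.subset v.2, hv⟩, rfl⟩, rfl⟩
  rw [this]
  exact hcl.isOpen_compl.inter (Set.toFinite _).isClosed.isOpen_compl

theorem cases (h : PolarSection Φ A B p N S) (y : Y) : y = N ∨ y = S ∨ ∃ v : A, p v = y := by
  have := h.isOpenEmbedding.2
  by_cases h1 : y = N
  · exact .inl h1
  by_cases h2 : y = S
  · exact .inr (.inl h2)
  have h3 : y ∈ range fun v : A => p v := by rw [this]; simp [h1, h2]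
  exact .inr (.inr h3)

theorem ne_north (h : PolarSection Φ A B p N S) (v : A) : p v ≠ N := ((h.mem_iff v).1 v.2).2.1

theorem ne_south (h : PolarSection Φ A B p N S) (v : A) : p v ≠ S := ((h.mem_iff v).1 v.2).2.2

open Classical in
/-- The extension of the return map to `Y`, fixing the poles. -/
def extendedMap (h : PolarSection Φ A B p N S) (y : Y) : Y :=
  if hy : ∃ v : A, p v = y then p (h.returnMap hy.choose) else y

theorem extendedMap_apply (h : PolarSection Φ A B p N S) (v : A) :
    h.extendedMap (p v) = p (h.returnMap v) := by
  have hy : ∃ w : A, p w = p v := ⟨v, rfl⟩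
  rw [extendedMap, dif_pos hy, h.isOpenEmbedding.1.injective hy.choose_spec]

theorem extendedMap_north (h : PolarSection Φ A B p N S) : h.extendedMap N = N :=
  dif_neg fun ⟨v, hv⟩ => h.ne_north v hv

theorem extendedMap_south (h : PolarSection Φ A B p N S) : h.extendedMap S = S :=
  dif_neg fun ⟨v, hv⟩ => h.ne_south v hv

/-- The return map moves points along orbits, so stability of the pole under all times gives
continuity whatever the return times are; they need not be bounded near the pole. -/
theorem continuousAt_extendedMap_north (h : PolarSection Φ A B p N S) :
    ContinuousAt h.extendedMap N := by
  rw [ContinuousAt, h.extendedMap_north]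
  intro U hU
  obtain ⟨V, hV, H⟩ := h.pole_stable hU
  rw [mem_map]
  filter_upwards [hV, isOpen_compl_singleton.mem_nhds h.ne] with y hy hyS
  rcases h.cases y with rfl | rfl | ⟨v, rfl⟩
  · rw [mem_preimage, h.extendedMap_north]; exact mem_of_mem_nhds hU
  · exact absurd rfl hyS
  · rw [mem_preimage, h.extendedMap_apply]
    exact H v (h.subset v.2) hy _ (h.subset (h.returnMap v).2)

theorem continuous_extendedMap (h : PolarSection Φ A B p N S) : Continuous h.extendedMap := by
  rw [continuous_iff_continuousAt]
  intro y
  rcases h.cases y with rfl | rfl | ⟨v, rfl⟩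
  · exact h.continuousAt_extendedMap_north
  · exact h.swap.continuousAt_extendedMap_north
  · rw [← h.isOpenEmbedding.1.continuousAt_iff (f := fun v : A => p v)]
    have : h.extendedMap ∘ (fun v : A => p v) = (fun v : A => p v) ∘ h.returnMap :=
      funext h.extendedMap_apply
    rw [this]
    exact (h.isOpenEmbedding.1.continuous.comp h.continuous_returnMap).continuousAt

/-- The extension of the return map as a homeomorphism. -/
def homeomorph (h : PolarSection Φ A B p N S) : Y ≃ₜ Y where
  toFun := h.extendedMap
  invFun := h.reverse.extendedMap
  left_inv y := by
    rcases h.cases y with rfl | rfl | ⟨v, rfl⟩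
    · rw [h.extendedMap_north, h.reverse.extendedMap_north]
    · rw [h.extendedMap_south, h.reverse.extendedMap_south]
    · rw [h.extendedMap_apply, h.reverse.extendedMap_apply, h.reverse_returnMap_returnMap]
  right_inv y := by
    rcases h.cases y with rfl | rfl | ⟨v, rfl⟩
    · rw [h.reverse.extendedMap_north, h.extendedMap_north]
    · rw [h.reverse.extendedMap_south, h.extendedMap_south]
    · rw [h.reverse.extendedMap_apply, h.extendedMap_apply, h.returnMap_reverse_returnMap]
  continuous_toFun := h.continuous_extendedMap
  continuous_invFun := h.reverse.continuous_extendedMap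

/-! ### Counting returns, and recurrence -/

theorem iterate_extendedMap (h : PolarSection Φ A B p N S) (n : ℕ) (v : A) :
    h.extendedMap^[n] (p v) = p (h.returnMap^[n] v) :=
  ((show Function.Semiconj (fun v : A => p v) h.returnMap h.extendedMap from
    fun v => (h.extendedMap_apply v).symm).iterate_right n v).symm

/-- The time of the `n`-th return. -/
def iterTime (h : PolarSection Φ A B p N S) (n : ℕ) (v : A) : ℝ :=
  ∑ i ∈ Finset.range n, h.returnTime (h.returnMap^[i] v)

theorem iterTime_succ (h : PolarSection Φ A B p N S) (n : ℕ) (v : A) :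
    h.iterTime (n + 1) v = h.iterTime n v + h.returnTime (h.returnMap^[n] v) :=
  Finset.sum_range_succ _ _

theorem strictMono_iterTime (h : PolarSection Φ A B p N S) (v : A) :
    StrictMono fun n => h.iterTime n v :=
  strictMono_nat_of_lt_succ fun n => by
    have := h.returnTime_pos (h.returnMap^[n] v)
    simp only [iterTime_succ]
    linarith

theorem continuous_iterTime (h : PolarSection Φ A B p N S) (n : ℕ) :
    Continuous (h.iterTime n) :=
  continuous_finsetSum _ fun i _ => h.continuous_returnTime.comp (h.continuous_returnMap.iterate i)

theorem flow_iterTime (h : PolarSection Φ A B p N S) (n : ℕ) (v : A) :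
    Φ (h.iterTime n v) v = (h.returnMap^[n] v : A) := by
  induction n with
  | zero => simp [iterTime]
  | succ n ih =>
    rw [iterTime_succ, add_comm, Φ.map_add, ih, Function.iterate_succ_apply']
    rfl

/-- Bounded return times would accumulate at some `a`. Then `Φ a v` is in `B`, hence in `A`, and
infinitely many returns close to time `a` contradict separation at this point. -/
theorem iterTime_unbounded (h : PolarSection Φ A B p N S) (v : A) (r : ℝ) :
    ∃ n, r < h.iterTime n v := by
  by_contra! hle
  have hbdd : BddAbove (range fun n => h.iterTime n v) := ⟨r, by rintro _ ⟨n, rfl⟩; exact hle n⟩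
  have hlim := tendsto_atTop_ciSup (h.strictMono_iterTime v).monotone hbdd
  set a := ⨆ n, h.iterTime n v
  have hΦ : Tendsto (fun n => Φ (h.iterTime n v) v) atTop (𝓝 (Φ a v)) :=
    ((Φ.continuous continuous_id continuous_const).tendsto a).comp hlim
  have haB : Φ a v ∈ B := h.isClosed.mem_of_tendsto hΦ <| .of_forall fun n => by
    rw [h.flow_iterTime]; exact h.subset (h.returnMap^[n] v).2
  have haA := h.mem_of_mem_closed v.2 haB
  obtain ⟨ε, hε, H⟩ := h.sep _ haA
  obtain ⟨n, hn⟩ := (Metric.tendsto_atTop.1 hlim) ε hε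
  have hret : ∀ n, Φ (h.iterTime n v - a) (Φ a v) ∈ A := fun n => by
    rw [← Φ.map_add, sub_add_cancel, h.flow_iterTime]; exact (h.returnMap^[n] v).2
  have := H.self_of_nhds _ _ (hn n le_rfl) (hn (n + 1) n.le_succ) (hret n) (hret (n + 1))
  have h2 := h.strictMono_iterTime v n.lt_succ_self
  simp only [Nat.succ_eq_add_one] at h2
  linarith

/-- The iterated return times exhaust the visits to `A`: a visit strictly between two consecutive
ones would contradict the minimality of a first return time. -/
theorem exists_eq_iterTime (h : PolarSection Φ A B p N S) (v : A) {s : ℝ} (hs : 0 < s)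
    (hA : Φ s v ∈ A) : ∃ n, h.iterTime n v = s := by
  classical
  have hex := h.iterTime_unbounded v s
  obtain ⟨n, hn⟩ : ∃ n, Nat.find hex = n + 1 := by
    refine Nat.exists_eq_succ_of_ne_zero fun h0 => ?_
    have := Nat.find_spec hex
    rw [h0] at this
    simp [iterTime] at this
    linarith
  have h1 := Nat.find_spec hex
  rw [hn] at h1
  have h2 := not_lt.1 (Nat.find_min hex (m := n) (by omega))
  refine ⟨n, le_antisymm h2 ?_⟩
  by_contra! hlt
  have := (h.returnTime_spec (h.returnMap^[n] v)).2
    (show s - h.iterTime n v ∈ {r : ℝ | 0 < r ∧ Φ r (h.returnMap^[n] v : A) ∈ A} from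
      ⟨by linarith, by rw [← h.flow_iterTime, ← Φ.map_add, sub_add_cancel]; exact hA⟩)
  rw [iterTime_succ] at h1
  linarith

/-- The separation time is made uniform over a neighbourhood of `C`, not only over `C`, because it
is applied at the points `Φ t v` with `v ∈ C`. -/
theorem sep_uniform (h : PolarSection Φ A B p N S) {C : Set X} (hC : IsCompact C) (hCA : C ⊆ A) :
    ∃ ε > 0, ∃ O, IsOpen O ∧ C ⊆ O ∧ ∀ u ∈ O, ∀ s s', |s| < ε → |s'| < ε → Φ s u ∈ A →
      Φ s' u ∈ A → s = s' := by
  refine hC.induction_on (p := fun C => ∃ ε > 0, ∃ O, IsOpen O ∧ C ⊆ O ∧ ∀ u ∈ O, ∀ s s' : ℝ,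
    |s| < ε → |s'| < ε → Φ s u ∈ A → Φ s' u ∈ A → s = s') ?_ ?_ ?_ ?_
  · exact ⟨1, one_pos, ∅, isOpen_empty, subset_rfl, by simp⟩
  · rintro s t hst ⟨ε, hε, O, hO, htO, H⟩
    exact ⟨ε, hε, O, hO, hst.trans htO, H⟩
  · rintro s t ⟨ε, hε, O, hO, hsO, H⟩ ⟨ε', hε', O', hO', htO', H'⟩
    refine ⟨min ε ε', lt_min hε hε', O ∪ O', hO.union hO', union_subset_union hsO htO', ?_⟩
    rintro u (hu | hu) s s' hs hs'
    · exact H u hu s s' (hs.trans_le (min_le_left _ _)) (hs'.trans_le (min_le_left _ _))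
    · exact H' u hu s s' (hs.trans_le (min_le_right _ _)) (hs'.trans_le (min_le_right _ _))
  · intro v hv
    obtain ⟨ε, hε, H⟩ := h.sep v (hCA hv)
    obtain ⟨O, hO, hOo, hvO⟩ := mem_nhds_iff.1 H
    exact ⟨O, mem_nhdsWithin_of_mem_nhds (hOo.mem_nhds hvO), ε, hε, O, hOo, subset_rfl,
      fun u hu => hO hu⟩

theorem exists_small_time (Φ : Flow ℝ X) {δ : ℝ} (hδ : 0 < δ) :
    ∃ ρ > 0, ∀ s, |s| < ρ → ∀ u, dist (Φ s u) u < δ := by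
  have hΦ : Continuous fun q : ℝ × X => Φ q.1 q.2 := Φ.continuous continuous_fst continuous_snd
  have := isCompact_univ.eventually_forall_of_forall_eventually (x₀ := (0 : ℝ))
    (P := fun s (u : X) => dist (Φ s u) u < δ) fun u _ => by
      have hc : Continuous fun q : ℝ × X => dist (Φ q.1 q.2) q.2 := hΦ.dist continuous_snd
      exact hc.continuousAt.eventually (gt_mem_nhds (by simpa using hδ))
  obtain ⟨ρ, hρ, H⟩ := Metric.eventually_nhds_iff.1 this
  exact ⟨ρ, hρ, fun s hs u => H (by simpa using hs) u (mem_univ u)⟩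

/-- On a compact connected part of the section, some late iterate of the return map is close to
the identity: near a time at which the flow is close to the identity there is exactly one return,
and the number of returns up to that time does not depend on the point. -/
theorem exists_iterate_close (h : PolarSection Φ A B p N S) {C : Set A} (hC : IsCompact C)
    (hCc : IsPreconnected C) (hCn : C.Nonempty) {δ : ℝ} (hδ : 0 < δ) (m : ℕ) :
    ∃ n ≥ m, ∀ v ∈ C, dist (h.returnMap^[n] v : X) v < δ := by
  obtain ⟨v₀, hv₀⟩ := hCn
  have hC' : IsCompact (Subtype.val '' C : Set X) := hC.image continuous_subtype_val
  have hCA : (Subtype.val '' C : Set X) ⊆ A := by rintro _ ⟨v, -, rfl⟩; exact v.2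
  obtain ⟨ρ₁, hρ₁, O, hO, hCO, hsep⟩ := h.sep_uniform hC' hCA
  obtain ⟨ρ₂, hρ₂, hsmall⟩ := exists_small_time Φ (half_pos hδ)
  set ρ := min ρ₁ ρ₂
  have hρ : 0 < ρ := lt_min hρ₁ hρ₂
  obtain ⟨δ₁, hδ₁, hO'⟩ := hC'.exists_thickening_subset_open
    (hO.inter (isOpen_interior (s := {u | ∃ s, |s| < ρ ∧ Φ s u ∈ A}))) fun v hv =>
      ⟨hCO hv, mem_interior_iff_mem_nhds.2 (h.hit v (hCA hv) ρ hρ)⟩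
  -- This bound forces the return near time `t` to come after the `m`-th return of `v₀`, so its
  -- index is at least `m`.
  obtain ⟨t, ht, hclose⟩ := exists_uniformly_recurrent_time Φ h.equi
    (lt_min hδ₁ (half_pos hδ)) (R := |h.iterTime m v₀| + ρ) (by positivity)
  have hnear : ∀ v ∈ C, Φ t v ∈ O ∩ interior {u | ∃ s, |s| < ρ ∧ Φ s u ∈ A} := fun v hv =>
    hO' (Metric.mem_thickening_iff.2 ⟨v, ⟨v, hv, rfl⟩, (hclose v).trans_le (min_le_left _ _)⟩)
  have hex : ∀ v ∈ C, ∃ n, |h.iterTime n v - t| < ρ := by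
    intro v hv
    obtain ⟨s, hs, hsA⟩ := interior_subset (hnear v hv).2
    rw [← Φ.map_add] at hsA
    obtain ⟨n, hn⟩ := h.exists_eq_iterTime v (s := s + t)
      (by linarith [(abs_lt.1 hs).1, abs_nonneg (h.iterTime m v₀)]) hsA
    exact ⟨n, by rw [hn]; simpa using hs⟩
  have huniq : ∀ v ∈ C, ∀ n n', |h.iterTime n v - t| < ρ → |h.iterTime n' v - t| < ρ →
      n = n' := by
    intro v hv n n' hn hn'
    refine (h.strictMono_iterTime v).injective ?_
    have hret : ∀ n, Φ (h.iterTime n v - t) (Φ t v) ∈ A := fun n => by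
      rw [← Φ.map_add, sub_add_cancel, h.flow_iterTime]; exact (h.returnMap^[n] v).2
    have := hsep _ (hnear v hv).1 _ _ (hn.trans_le (min_le_left _ _))
      (hn'.trans_le (min_le_left _ _)) (hret n) (hret n')
    simpa using this
  choose! f hf using hex
  -- The index of the return near `t` is locally constant: by continuity of the iterated return
  -- times the same index serves for nearby points, and the index is unique.
  have hfc : ContinuousOn f C := by
    intro v hv
    have h1 : ∀ᶠ w in 𝓝[C] v, |h.iterTime (f v) w - t| < ρ := by
      have hc : Continuous fun w => |h.iterTime (f v) w - t| :=
        ((h.continuous_iterTime _).sub continuous_const).abs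
      exact mem_nhdsWithin_of_mem_nhds (hc.continuousAt.eventually (gt_mem_nhds (hf v hv)))
    refine tendsto_const_nhds.congr' ?_
    filter_upwards [h1, self_mem_nhdsWithin] with w hw hwC
    exact huniq w hwC _ _ hw (hf w hwC)
  refine ⟨f v₀, ?_, fun v hv => ?_⟩
  · have h1 := (abs_lt.1 (hf v₀ hv₀)).1
    have h2 := le_abs_self (h.iterTime m v₀)
    exact ((h.strictMono_iterTime v₀).lt_iff_lt (a := m) (b := f v₀)).1 (by linarith) |>.le
  · rw [hCc.constant hfc hv₀ hv, ← h.flow_iterTime]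
    have h1 := hsmall (h.iterTime (f v) v - t) ((hf v hv).trans_le (min_le_right _ _)) (Φ t v)
    rw [← Φ.map_add, sub_add_cancel] at h1
    have h2 := (hclose v).trans_le (min_le_right _ _)
    linarith [dist_triangle (Φ (h.iterTime (f v) v) v) (Φ t v) v]

theorem iterate_north (h : PolarSection Φ A B p N S) (n : ℕ) : h.extendedMap^[n] N = N :=
  Function.iterate_fixed h.extendedMap_north n

/-- Three regions are treated separately. Near each pole, points and all their iterates stay within
`ε / 2` of the pole; the rest lies in a connected core, on which one iterate is close to the
identity. -/
theorem exists_iterate_extendedMap_close (h : PolarSection Φ A B p N S) {ε : ℝ} (hε : 0 < ε)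
    (m : ℕ) : ∃ n ≥ m, ∀ y, dist (h.extendedMap^[n] y) y < ε := by
  obtain ⟨V, hV, HV⟩ := h.pole_stable (Metric.ball_mem_nhds N (half_pos hε))
  obtain ⟨W, hW, HW⟩ := h.swap.pole_stable (Metric.ball_mem_nhds S (half_pos hε))
  obtain ⟨K, hKc, hKp, hKn, hNK, hSK, hK⟩ := h.core _
    (inter_mem hV (Metric.ball_mem_nhds N (half_pos hε))) _
    (inter_mem hW (Metric.ball_mem_nhds S (half_pos hε)))
  have hemb := h.isOpenEmbedding
  have hKr : K ⊆ range (fun v : A => p v) := by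
    rw [hemb.2]
    intro y hy
    simp only [mem_compl_iff, mem_insert_iff, mem_singleton_iff, not_or]
    exact ⟨fun e => hNK (e ▸ hy), fun e => hSK (e ▸ hy)⟩
  have hCcomp : IsCompact ((fun v : A => p v) ⁻¹' K) := by
    rw [Subtype.isCompact_iff]
    convert (h.cont.preimage_isClosed_of_isClosed h.isClosed hKc).isCompact using 1
    ext v
    constructor
    · rintro ⟨v, hv, rfl⟩
      exact ⟨h.subset v.2, hv⟩
    · rintro ⟨hv, hvK⟩
      exact ⟨⟨v, (h.mem_iff v).2 ⟨hv, fun e => hNK (e ▸ hvK), fun e => hSK (e ▸ hvK)⟩⟩, hvK, rfl⟩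
  -- Closeness was obtained in `X`; uniform continuity of `p` on the compact set `B` carries it to
  -- `Y`.
  obtain ⟨δ, hδ, hunif⟩ := Metric.uniformContinuousOn_iff.1
    (h.isClosed.isCompact.uniformContinuousOn_of_continuous h.cont) ε hε
  obtain ⟨y₀, hy₀⟩ := hKn
  obtain ⟨n, hn, H⟩ := h.exists_iterate_close hCcomp
    (hKp.preimage_of_isOpenMap hemb.1.injective hemb.1.isOpenMap hKr)
    (by obtain ⟨v, hv⟩ := hKr hy₀; exact ⟨v, by simpa [hv] using hy₀⟩) hδ m
  refine ⟨n, hn, fun y => ?_⟩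
  rcases h.cases y with rfl | rfl | ⟨v, rfl⟩
  · rwa [h.iterate_north, dist_self]
  · rw [show h.extendedMap = h.swap.extendedMap from rfl, h.swap.iterate_north]; rwa [dist_self]
  · rw [h.iterate_extendedMap]
    rcases hK (p v) with hv | hv | hv
    · exact hunif _ (h.subset (h.returnMap^[n] v).2) _ (h.subset v.2) (H v hv)
    · have := HV v (h.subset v.2) hv.1 (h.iterTime n v)
        (by rw [h.flow_iterTime]; exact h.subset (h.returnMap^[n] v).2)
      rw [h.flow_iterTime] at this
      linarith [dist_triangle_right (p (h.returnMap^[n] v : A)) (p v) N, Metric.mem_ball.1 this,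
        Metric.mem_ball.1 hv.2]
    · have := HW v (h.subset v.2) hv.1 (h.iterTime n v)
        (by rw [h.flow_iterTime]; exact h.subset (h.returnMap^[n] v).2)
      rw [h.flow_iterTime] at this
      linarith [dist_triangle_right (p (h.returnMap^[n] v : A)) (p v) S, Metric.mem_ball.1 this,
        Metric.mem_ball.1 hv.2]

theorem isRecurrent (h : PolarSection Φ A B p N S) : IsRecurrent h.homeomorph := by
  refine ⟨h.homeomorph.continuous, ?_⟩
  choose n hn H using fun k : ℕ => h.exists_iterate_extendedMap_close
    (ε := 1 / ((k : ℝ) + 1)) (by positivity) k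
  refine ⟨n, tendsto_atTop_mono hn tendsto_id, ?_⟩
  have hlim : Tendsto (fun k : ℕ => ENNReal.ofReal (1 / ((k : ℝ) + 1))) atTop (𝓝 0) := by
    simpa using ENNReal.tendsto_ofReal (tendsto_one_div_add_atTop_nhds_zero_nat (𝕜 := ℝ))
  refine tendsto_of_tendsto_of_tendsto_of_le_of_le tendsto_const_nhds hlim (fun k => zero_le)
    fun k => iSup_le fun y => ?_
  rw [edist_dist]
  exact ENNReal.ofReal_le_ofReal (H k y).le

end PolarSection

/-- The first return map to a polar section extends to a recurrent homeomorphism. -/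
theorem PolarSection.exists_returnMap {X Y : Type*} [MetricSpace X] [CompactSpace X]
    [MetricSpace Y] {Φ : Flow ℝ X} {A B : Set X} {p : X → Y} {N S : Y}
    (h : PolarSection Φ A B p N S) : ∃ (F : A → A) (F' : Y ≃ₜ Y), IsFirstReturnMap Φ A F ∧
      (∀ v : A, F' (p v) = p (F v)) ∧ F' N = N ∧ F' S = S ∧ IsRecurrent F' :=
  ⟨h.returnMap, h.homeomorph, fun v => ⟨h.returnTime v, h.returnTime_spec v, rfl⟩,
    h.extendedMap_apply, h.extendedMap_north, h.extendedMap_south, h.isRecurrent⟩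

/-! ### Compactness of the unit tangent bundle -/

section Surface

variable {M : Type*} [TopologicalSpace M] [ChartedSpace Plane M] [IsManifold (𝓡 2) ∞ M]
  [RiemannianBundle (fun x : M => TangentSpace (𝓡 2) x)]
  [IsContMDiffRiemannianBundle (𝓡 2) ∞ Plane (fun x : M => TangentSpace (𝓡 2) x)]

instance isContinuousRiemannianBundle_tangentSpace :
    IsContinuousRiemannianBundle Plane (fun x : M => TangentSpace (𝓡 2) x) := by
  obtain ⟨g, hg, h⟩ := IsContMDiffRiemannianBundle.exists_contMDiff (IB := 𝓡 2) (n := ∞)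
    (F := Plane) (E := fun x : M => TangentSpace (𝓡 2) x)
  exact ⟨g, hg.continuous, h⟩

theorem continuous_norm_tangentBundle :
    Continuous fun v : TangentBundle (𝓡 2) M => ‖v.2‖ := by
  have h : Continuous fun v : TangentBundle (𝓡 2) M => inner ℝ v.2 v.2 :=
    Continuous.inner_bundle (F := Plane) (E := fun x : M => TangentSpace (𝓡 2) x)
      (b := fun v : TangentBundle (𝓡 2) M => v.1) (v := fun v => v.2) (w := fun v => v.2)
      continuous_id continuous_id
  simp_rw [norm_eq_sqrt_real_inner]
  exact h.sqrt

instance compactSpace_unitTangent [T2Space M] [CompactSpace M] :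
    CompactSpace (UnitTangent M) := by
  apply isCompact_iff_compactSpace.1
  have key : ∀ x : M, ∃ K ∈ 𝓝 x, IsCompact {v : TangentBundle (𝓡 2) M | v.1 ∈ K ∧ ‖v.2‖ = 1} := by
    intro x
    obtain ⟨C, hC, H⟩ := eventually_norm_trivializationAt_lt Plane
      (fun x : M => TangentSpace (𝓡 2) x) x
    set e := trivializationAt Plane (fun x : M => TangentSpace (𝓡 2) x) x
    have hb : e.baseSet ∈ 𝓝 x :=
      e.open_baseSet.mem_nhds (FiberBundle.mem_baseSet_trivializationAt' x)
    obtain ⟨K, hK, hKs, hKc⟩ := local_compact_nhds (inter_mem hb H)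
    refine ⟨K, hK, ?_⟩
    -- Over `K` the trivialization has norm less than `C` on fibres, so unit vectors correspond to a
    -- closed subset of `K` times a ball.
    have hcomp : IsCompact (e.toOpenPartialHomeomorph.symm ''
        (K ×ˢ Metric.closedBall (0 : Plane) C)) := by
      refine (hKc.prod (isCompact_closedBall _ _)).image_of_continuousOn
        (e.toOpenPartialHomeomorph.continuousOn_symm.mono ?_)
      rintro ⟨y, w⟩ hy
      exact e.mem_target.2 (hKs hy.1).1
    convert hcomp.inter_right (isClosed_singleton (x := (1 : ℝ)).preimage
      (continuous_norm_tangentBundle (M := M))) using 1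
    ext v
    constructor
    · rintro ⟨hv, hv1⟩
      refine ⟨⟨e v, ⟨?_, ?_⟩, ?_⟩, hv1⟩
      · rwa [e.coe_fst' (hKs hv).1]
      · rw [mem_closedBall_zero_iff]
        have h1 := (e.continuousLinearMapAt ℝ v.1).le_opNorm v.2
        have h2 : ‖e.continuousLinearMapAt ℝ v.1‖ < C := (hKs hv).2
        rw [Trivialization.continuousLinearMapAt_apply, Trivialization.linearMapAt_apply,
          if_pos (hKs hv).1] at h1
        rw [hv1, mul_one] at h1
        exact h1.trans h2.le
      · exact e.toOpenPartialHomeomorph.left_inv (e.mem_source.2 (hKs hv).1)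
    · rintro ⟨⟨q, hq, rfl⟩, h1⟩
      refine ⟨?_, h1⟩
      have := e.proj_symm_apply' (hKs hq.1).1 (x := q.2)
      rw [show (e.toOpenPartialHomeomorph.symm q).1 = q.1 from this]
      exact hq.1
  choose K hK hKc using key
  obtain ⟨t, -, ht⟩ := isCompact_univ.elim_nhds_subcover K fun x _ => hK x
  refine (t.isCompact_biUnion fun x _ => hKc x).of_isClosed_subset
    (isClosed_singleton (x := (1 : ℝ)).preimage (continuous_norm_tangentBundle (M := M))) ?_
  intro v hv
  obtain ⟨x, hx, hvx⟩ := mem_iUnion₂.1 (ht (mem_univ v.1))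
  exact mem_iUnion₂.2 ⟨x, hx, hvx, hv⟩

end Surface

/-! ### Tangent vectors and the metric in charts -/

section Surface

variable {M : Type*} [TopologicalSpace M] [ChartedSpace Plane M] [IsManifold (𝓡 2) ∞ M]

/-- The unit tangent vectors of a curve as points of the tangent bundle. -/
def tangentLift (σ : ℝ → M) (t : ℝ) : TangentBundle (𝓡 2) M := ⟨σ t, velocity σ t⟩

theorem continuous_tangentLift {σ : ℝ → M} (hσ : ContMDiff 𝓘(ℝ, ℝ) (𝓡 2) ∞ σ) :
    Continuous (tangentLift σ) := by
  have h1 : Continuous (tangentMap 𝓘(ℝ, ℝ) (𝓡 2) σ) := hσ.continuous_tangentMap (by simp)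
  have h2 : Continuous (fun t : ℝ => (⟨t, (1 : ℝ)⟩ : TangentBundle 𝓘(ℝ, ℝ) ℝ)) := by
    have := (tangentBundleModelSpaceHomeomorph 𝓘(ℝ, ℝ)).symm.continuous.comp
      (Continuous.prodMk_left (1 : ℝ) (X := ℝ))
    exact this
  exact h1.comp h2

/-- The coordinate vector of a tangent vector with respect to a chart. -/
def coordVec (e : OpenPartialHomeomorph M Plane) (v : TangentBundle (𝓡 2) M) : Plane :=
  mfderiv (𝓡 2) (𝓡 2) e v.1 v.2

theorem continuousOn_coordVec {e : OpenPartialHomeomorph M Plane}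
    (he : e ∈ IsManifold.maximalAtlas (𝓡 2) ∞ M) :
    ContinuousOn (coordVec e) {v | v.1 ∈ e.source} := by
  have h1 : ContinuousOn (tangentMapWithin (𝓡 2) (𝓡 2) e e.source) {v | v.1 ∈ e.source} :=
    (contMDiffOn_of_mem_maximalAtlas he).continuousOn_tangentMapWithin (by simp)
      e.open_source.uniqueMDiffOn
  have h2 := (continuous_snd.comp
    (tangentBundleModelSpaceHomeomorph (𝓡 2)).continuous).comp_continuousOn h1
  refine h2.congr fun v hv => ?_
  simp only [coordVec, Function.comp, tangentMapWithin]
  rw [mfderivWithin_of_isOpen e.open_source hv]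
  rfl

theorem hasDerivAt_chart_comp {e : OpenPartialHomeomorph M Plane}
    (he : e ∈ IsManifold.maximalAtlas (𝓡 2) ∞ M) {σ : ℝ → M}
    (hσ : ContMDiff 𝓘(ℝ, ℝ) (𝓡 2) ∞ σ) {t : ℝ} (ht : σ t ∈ e.source) :
    HasDerivAt (fun s => e (σ s)) (coordVec e (tangentLift σ t)) t := by
  have h1 : MDifferentiableAt (𝓡 2) (𝓡 2) e (σ t) :=
    (contMDiffAt_of_mem_maximalAtlas he ht).mdifferentiableAt (by simp)
  have h2 : MDifferentiableAt 𝓘(ℝ, ℝ) (𝓡 2) σ t := (hσ t).mdifferentiableAt (by simp)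
  have h3 : HasFDerivAt (fun s => e (σ s))
      (show ℝ →L[ℝ] Plane from (mfderiv (𝓡 2) (𝓡 2) e (σ t)).comp (mfderiv 𝓘(ℝ, ℝ) (𝓡 2) σ t)) t :=
    (h1.hasMFDerivAt.comp t h2.hasMFDerivAt).hasFDerivAt
  exact h3.hasDerivAt

theorem injective_mfderiv_chart {e : OpenPartialHomeomorph M Plane}
    (he : e ∈ IsManifold.maximalAtlas (𝓡 2) ∞ M) {x : M} (hx : x ∈ e.source) :
    Function.Injective (mfderiv (𝓡 2) (𝓡 2) e x) := by
  have h : e.MDifferentiable (𝓡 2) (𝓡 2) :=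
    ⟨(contMDiffOn_of_mem_maximalAtlas he).mdifferentiableOn (by simp),
      (contMDiffOn_symm_of_mem_maximalAtlas he).mdifferentiableOn (by simp)⟩
  exact h.mfderiv_injective hx

theorem coordVec_injOn {e : OpenPartialHomeomorph M Plane}
    (he : e ∈ IsManifold.maximalAtlas (𝓡 2) ∞ M) {v w : TangentBundle (𝓡 2) M}
    (hv : v.1 ∈ e.source) (h1 : v.1 = w.1) (h2 : coordVec e v = coordVec e w) : v = w := by
  obtain ⟨x, v⟩ := v
  obtain ⟨y, w⟩ := w
  obtain rfl : x = y := h1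
  exact congrArg (TotalSpace.mk x) (injective_mfderiv_chart he hv h2)

variable [RiemannianBundle (fun x : M => TangentSpace (𝓡 2) x)]

theorem chartMetric_add_left (p : M) (y u u' w : Plane) :
    chartMetric p y (u + u') w = chartMetric p y u w + chartMetric p y u' w := by
  simp only [chartMetric]
  rw [← inner_add_left]
  congr 1
  exact map_add (mfderiv (𝓡 2) (𝓡 2) (extChartAt (𝓡 2) p).symm y) u u'

theorem chartMetric_smul_left (p : M) (y : Plane) (a : ℝ) (u w : Plane) :
    chartMetric p y (a • u) w = a * chartMetric p y u w := by
  simp only [chartMetric]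
  rw [← real_inner_smul_left]
  congr 1
  exact map_smul (mfderiv (𝓡 2) (𝓡 2) (extChartAt (𝓡 2) p).symm y) a u

theorem chartMetric_comm (p : M) (y u w : Plane) :
    chartMetric p y u w = chartMetric p y w u := real_inner_comm _ _

theorem chartMetric_neg_left (p : M) (y u w : Plane) :
    chartMetric p y (-u) w = -chartMetric p y u w := by
  rw [← neg_one_smul ℝ, chartMetric_smul_left, neg_one_mul]

theorem chartMetric_neg_right (p : M) (y u w : Plane) :
    chartMetric p y u (-w) = -chartMetric p y u w := by
  rw [chartMetric_comm, chartMetric_neg_left, chartMetric_comm]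

theorem chartMetric_self_pos {p : M} {y : Plane} (hy : y ∈ (extChartAt (𝓡 2) p).target) {u : Plane}
    (hu : u ≠ 0) : 0 < chartMetric p y u u := by
  simp only [chartMetric]
  rw [real_inner_self_eq_norm_sq]
  have hinj : Function.Injective (mfderiv (𝓡 2) (𝓡 2) (extChartAt (𝓡 2) p).symm y) := by
    have := (isInvertible_mfderivWithin_extChartAt_symm hy).injective
    rw [ModelWithCorners.range_eq_univ, mfderivWithin_univ] at this
    exact this
  have h0 : (mfderiv (𝓡 2) (𝓡 2) (extChartAt (𝓡 2) p).symm y u :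
      TangentSpace (𝓡 2) ((extChartAt (𝓡 2) p).symm y)) ≠ 0 := fun h => hu (hinj (by
    rw [h]; exact (map_zero (mfderiv (𝓡 2) (𝓡 2) (extChartAt (𝓡 2) p).symm y)).symm))
  have := norm_pos_iff.2 h0
  positivity

/-- The quadratic dependence on the velocity is what makes the geodesic equation invariant under
time reversal. -/
theorem christoffel_neg (p : M) (y u w : Plane) :
    christoffel p y (-u) (-u) w = christoffel p y u u w := by
  simp only [christoffel, chartMetric_neg_left, chartMetric_neg_right, map_neg, neg_neg]
  rw [fderiv_fun_neg]
  simp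

variable [IsContMDiffRiemannianBundle (𝓡 2) ∞ Plane (fun x : M => TangentSpace (𝓡 2) x)]

/-- The differential of the inverse chart is the inverse of the trivialization of the tangent bundle
at `p`, so coordinate vectors depend smoothly on all data and the smooth metric can be applied to
them. -/
theorem contDiffOn_chartMetric (p : M) :
    ContDiffOn ℝ ∞ (fun q : Plane × Plane × Plane => chartMetric p q.1 q.2.1 q.2.2)
      ((extChartAt (𝓡 2) p).target ×ˢ univ) := by
  have key : ∀ f : Plane × Plane × Plane → Plane, ContDiff ℝ ∞ f →
      ContMDiffOn 𝓘(ℝ, Plane × Plane × Plane) ((𝓡 2).prod 𝓘(ℝ, Plane)) ∞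
      (fun q : Plane × Plane × Plane => (⟨(extChartAt (𝓡 2) p).symm q.1,
        mfderiv (𝓡 2) (𝓡 2) (extChartAt (𝓡 2) p).symm q.1 (f q)⟩ : TangentBundle (𝓡 2) M))
      ((extChartAt (𝓡 2) p).target ×ˢ univ) := by
    intro f hf
    have h1 := (trivializationAt Plane (TangentSpace (𝓡 2) : M → Type _) p).contMDiffOn_symm
      (IB := 𝓡 2) (n := ∞)
    have h2 : ContMDiffOn 𝓘(ℝ, Plane × Plane × Plane) ((𝓡 2).prod 𝓘(ℝ, Plane)) ∞
        (fun q : Plane × Plane × Plane => ((extChartAt (𝓡 2) p).symm q.1, f q))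
        ((extChartAt (𝓡 2) p).target ×ˢ univ) := by
      refine ContMDiffOn.prodMk ?_ hf.contMDiff.contMDiffOn
      exact (contMDiffOn_extChartAt_symm p).comp contDiff_fst.contMDiff.contMDiffOn
        fun q hq => hq.1
    have hsrc : ∀ q : Plane × Plane × Plane, q ∈ (extChartAt (𝓡 2) p).target ×ˢ univ →
        (extChartAt (𝓡 2) p).symm q.1 ∈ (chartAt Plane p).source := fun q hq => by
      rw [← extChartAt_source (𝓡 2)]; exact (extChartAt (𝓡 2) p).map_target hq.1
    refine (h1.comp h2 fun q hq => ?_).congr fun q hq => ?_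
    · rw [mem_preimage, Trivialization.mem_target]
      exact hsrc q hq
    · simp only [Function.comp]
      rw [← Trivialization.mk_symm _ (hsrc q hq), ← Trivialization.symmL_apply (R := ℝ),
        TangentBundle.symmL_trivializationAt (hsrc q hq), (extChartAt (𝓡 2) p).right_inv hq.1,
        ModelWithCorners.range_eq_univ, mfderivWithin_univ]
      · rfl
      · exact hsrc q hq
  have := (key (fun q => q.2.1) (by fun_prop)).inner_bundle (key (fun q => q.2.2) (by fun_prop))
  exact contMDiffOn_iff_contDiffOn.1 this

end Surface

/-! ### The geodesic equation as an ODE, and uniqueness of geodesics -/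

section Surface

variable {M : Type*} [TopologicalSpace M] [ChartedSpace Plane M] [IsManifold (𝓡 2) ∞ M]
  [RiemannianBundle (fun x : M => TangentSpace (𝓡 2) x)]
  [IsContMDiffRiemannianBundle (𝓡 2) ∞ Plane (fun x : M => TangentSpace (𝓡 2) x)]

theorem contDiffAt_christoffel (p : M) (w : Plane) {q : Plane × Plane}
    (hq : q.1 ∈ (extChartAt (𝓡 2) p).target) :
    ContDiffAt ℝ ∞ (fun q : Plane × Plane => christoffel p q.1 q.2 q.2 w) q := by
  have hT : IsOpen (extChartAt (𝓡 2) p).target := isOpen_extChartAt_target p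
  have hg : ∀ f : (Plane × Plane) × Plane → Plane × Plane × Plane, ContDiff ℝ ∞ f →
      (∀ r, (f r).1 = r.2) →
      ContDiffAt ℝ ∞ (fun r => chartMetric p (f r).1 (f r).2.1 (f r).2.2) (q, q.1) := by
    intro f hf h1
    have := (contDiffOn_chartMetric p).contDiffAt (x := f (q, q.1))
      ((hT.prod isOpen_univ).mem_nhds ⟨by rw [h1]; exact hq, mem_univ _⟩)
    exact this.comp (q, q.1) hf.contDiffAt
  have h1 : ContDiffAt ℝ ∞ (fun q : Plane × Plane =>
      fderiv ℝ (fun z => chartMetric p z q.2 w) q.1) q :=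
    ContDiffAt.fderiv (n := ∞) (hg (fun r => (r.2, r.1.2, w)) (by fun_prop) fun _ => rfl)
      contDiffAt_fst (by simp)
  have h2 : ContDiffAt ℝ ∞ (fun q : Plane × Plane =>
      fderiv ℝ (fun z => chartMetric p z q.2 q.2) q.1) q :=
    ContDiffAt.fderiv (n := ∞) (hg (fun r => (r.2, r.1.2, r.1.2)) (by fun_prop) fun _ => rfl)
      contDiffAt_fst (by simp)
  simp only [christoffel]
  exact (((h1.clm_apply contDiffAt_snd).add (h1.clm_apply contDiffAt_snd)).sub
    (h2.clm_apply contDiffAt_const)).div_const 2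

/-- The coordinate vectors of the plane. -/
def planeBasis (i : Fin 2) : Plane := EuclideanSpace.single i 1

theorem plane_eq_smul_add_smul (u : Plane) : u = u 0 • planeBasis 0 + u 1 • planeBasis 1 := by
  ext i; fin_cases i <;> simp [planeBasis]

/-- The determinant of the metric in a chart. -/
def gramDet (p : M) (y : Plane) : ℝ :=
  chartMetric p y (planeBasis 0) (planeBasis 0) * chartMetric p y (planeBasis 1) (planeBasis 1)
    - chartMetric p y (planeBasis 0) (planeBasis 1) ^ 2

theorem gramDet_ne_zero {p : M} {y : Plane} (hy : y ∈ (extChartAt (𝓡 2) p).target) :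
    gramDet p y ≠ 0 := by
  intro h0
  have h1 : 0 < chartMetric p y (planeBasis 1) (planeBasis 1) :=
    chartMetric_self_pos hy (by simp [planeBasis])
  set E := chartMetric p y (planeBasis 0) (planeBasis 0)
  set F := chartMetric p y (planeBasis 0) (planeBasis 1) with hF
  set G := chartMetric p y (planeBasis 1) (planeBasis 1)
  -- The squared length of this test vector is `G (E G - F ^ 2)`, which gives the strict
  -- Cauchy–Schwarz inequality.
  have h2 : G • planeBasis 0 + (-F) • planeBasis 1 ≠ 0 := fun h => h1.ne' (by
    simpa [planeBasis] using congrArg (fun u : Plane => u 0) h)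
  have h3 := chartMetric_self_pos hy h2
  rw [chartMetric_add_left, chartMetric_smul_left, chartMetric_smul_left,
    chartMetric_comm _ _ (planeBasis 0), chartMetric_comm _ _ (planeBasis 1),
    chartMetric_add_left, chartMetric_smul_left, chartMetric_smul_left,
    chartMetric_add_left, chartMetric_smul_left, chartMetric_smul_left,
    chartMetric_comm p y (planeBasis 1) (planeBasis 0), ← hF] at h3
  have h4 : gramDet p y = E * G - F ^ 2 := rfl
  rw [h4] at h0
  nlinarith

/-- The vector field in the coordinates `(x, x')` whose integral curves are the geodesics. -/
def geodesicField (p : M) (q : Plane × Plane) : Plane × Plane :=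
  (q.2, (-(christoffel p q.1 q.2 q.2 (planeBasis 0) *
      chartMetric p q.1 (planeBasis 1) (planeBasis 1)
      - christoffel p q.1 q.2 q.2 (planeBasis 1) * chartMetric p q.1 (planeBasis 0) (planeBasis 1))
      / gramDet p q.1) • planeBasis 0 +
    (-(christoffel p q.1 q.2 q.2 (planeBasis 1) * chartMetric p q.1 (planeBasis 0) (planeBasis 0)
      - christoffel p q.1 q.2 q.2 (planeBasis 0) * chartMetric p q.1 (planeBasis 0) (planeBasis 1))
      / gramDet p q.1) • planeBasis 1)

theorem contDiffAt_geodesicField {p : M} {q : Plane × Plane}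
    (hq : q.1 ∈ (extChartAt (𝓡 2) p).target) : ContDiffAt ℝ 1 (geodesicField p) q := by
  have hT : IsOpen (extChartAt (𝓡 2) p).target := isOpen_extChartAt_target p
  have hg : ∀ i j, ContDiffAt ℝ 1 (fun r : Plane × Plane =>
      chartMetric p r.1 (planeBasis i) (planeBasis j)) q := by
    intro i j
    have := (contDiffOn_chartMetric p).contDiffAt (x := (q.1, planeBasis i, planeBasis j))
      ((hT.prod isOpen_univ).mem_nhds ⟨hq, mem_univ _⟩)
    exact (this.of_le (m := 1) (mod_cast le_top)).comp q (contDiffAt_fst.prodMk contDiffAt_const)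
  have hΓ : ∀ i, ContDiffAt ℝ 1 (fun r : Plane × Plane =>
      christoffel p r.1 r.2 r.2 (planeBasis i)) q := fun i =>
    (contDiffAt_christoffel p _ hq).of_le (by simp)
  have hD : ContDiffAt ℝ 1 (fun r : Plane × Plane => gramDet p r.1) q :=
    ((hg 0 0).mul (hg 1 1)).sub ((hg 0 1).pow 2)
  have hD0 := gramDet_ne_zero hq
  exact contDiffAt_snd.prodMk
    (((((((hΓ 0).mul (hg 1 1)).sub ((hΓ 1).mul (hg 0 1))).neg).div hD hD0).smul
      contDiffAt_const).add
    ((((((hΓ 1).mul (hg 0 0)).sub ((hΓ 0).mul (hg 0 1))).neg).div hD hD0).smul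
      contDiffAt_const))

theorem IsGeodesic.hasDerivAt_geodesicField {σ : ℝ → M} (hσ : IsGeodesic σ) (p : M) {t : ℝ}
    (ht : σ t ∈ (chartAt Plane p).source) :
    HasDerivAt (fun s => ((extChartAt (𝓡 2) p (σ s), deriv (fun s => extChartAt (𝓡 2) p (σ s)) s) :
      Plane × Plane)) (geodesicField p (extChartAt (𝓡 2) p (σ t),
        deriv (fun s => extChartAt (𝓡 2) p (σ s)) t)) t := by
  set c : ℝ → Plane := fun s => extChartAt (𝓡 2) p (σ s) with hc
  have hsm : ContDiffAt ℝ ∞ c t := by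
    have h1 : ContMDiffAt (𝓡 2) 𝓘(ℝ, Plane) ∞ (extChartAt (𝓡 2) p) (σ t) :=
      contMDiffAt_extChartAt' ht
    exact contMDiffAt_iff_contDiffAt.1 (h1.comp t (hσ.smooth t))
  have hd1 : HasDerivAt c (deriv c t) t := (hsm.differentiableAt (by simp)).hasDerivAt
  have hd2 : HasDerivAt (deriv c) (deriv (deriv c) t) t := by
    have h2 : ContDiffAt ℝ ∞ (fun s => fderiv ℝ c s 1) t :=
      (hsm.fderiv_right (m := ∞) (by simp)).clm_apply contDiffAt_const
    have h3 : (fun s => fderiv ℝ c s 1) = deriv c := by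
      ext s : 1; exact fderiv_apply_one_eq_deriv
    rw [h3] at h2
    exact (h2.differentiableAt (by simp)).hasDerivAt
  have hy : c t ∈ (extChartAt (𝓡 2) p).target :=
    (extChartAt (𝓡 2) p).map_source (by rwa [extChartAt_source])
  convert hd1.prodMk hd2 using 1
  have h0 := hσ.equation p t ht (planeBasis 0)
  have h1 := hσ.equation p t ht (planeBasis 1)
  simp only at h0 h1
  have hD := gramDet_ne_zero hy
  rw [geodesicField, Prod.mk.injEq]
  refine ⟨rfl, ?_⟩
  rw [plane_eq_smul_add_smul (deriv (deriv c) t), chartMetric_add_left, chartMetric_smul_left,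
    chartMetric_smul_left] at h0 h1
  rw [plane_eq_smul_add_smul (deriv (deriv c) t)]
  simp only
  rw [chartMetric_comm p (c t) (planeBasis 1) (planeBasis 0)] at h0
  -- The two lowered equations are a linear system for the second derivative with the Gram matrix as
  -- coefficients; the field was defined by Cramer's rule.
  congr 2
  · rw [div_eq_iff hD, gramDet]
    linear_combination chartMetric p (c t) (planeBasis 0) (planeBasis 1) * h1 -
      chartMetric p (c t) (planeBasis 1) (planeBasis 1) * h0
  · rw [div_eq_iff hD, gramDet]
    linear_combination chartMetric p (c t) (planeBasis 0) (planeBasis 1) * h0 -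
      chartMetric p (c t) (planeBasis 0) (planeBasis 0) * h1

/-- In the chart at the common point both curves, with their derivatives, solve the same first-order
system. Its field is `C¹`, hence locally Lipschitz, and the solution is unique. -/
theorem IsGeodesic.eventuallyEq {σ τ : ℝ → M} (hσ : IsGeodesic σ) (hτ : IsGeodesic τ) {t : ℝ}
    (h : tangentLift σ t = tangentLift τ t) : tangentLift σ =ᶠ[𝓝 t] tangentLift τ := by
  set p := σ t with hp
  have hpt : τ t = p := (congrArg TotalSpace.proj h).symm
  have he : chartAt Plane p ∈ IsManifold.maximalAtlas (𝓡 2) ∞ M :=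
    IsManifold.chart_mem_maximalAtlas p
  have hps := mem_chart_source Plane p
  have hev : ∀ {σ : ℝ → M}, IsGeodesic σ → σ t = p → ∀ᶠ s in 𝓝 t, σ s ∈ (chartAt Plane p).source :=
    fun hσ h1 => hσ.smooth.continuous.continuousAt.preimage_mem_nhds
      ((chartAt Plane p).open_source.mem_nhds (h1 ▸ hps))
  have hderiv : ∀ {σ : ℝ → M}, IsGeodesic σ → ∀ {s}, σ s ∈ (chartAt Plane p).source →
      deriv (fun s => extChartAt (𝓡 2) p (σ s)) s = coordVec (chartAt Plane p) (tangentLift σ s) :=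
    fun hσ s hs => (hasDerivAt_chart_comp he hσ.smooth hs).deriv
  have hstate : ∀ {σ : ℝ → M} {s}, σ s = p → IsGeodesic σ →
     ((extChartAt (𝓡 2) p (σ s), deriv (fun s => extChartAt (𝓡 2) p (σ s)) s) : Plane × Plane) =
      (extChartAt (𝓡 2) p p, coordVec (chartAt Plane p) (tangentLift σ s)) := fun h1 hσ => by
    rw [hderiv hσ (h1 ▸ hps), h1]
  obtain ⟨K, s, hs, hK⟩ := (contDiffAt_geodesicField (p := p)
    (q := (extChartAt (𝓡 2) p p, coordVec (chartAt Plane p) (tangentLift σ t)))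
    (mem_extChartAt_target p)).exists_lipschitzOnWith
  have hmem : ∀ {σ' : ℝ → M}, IsGeodesic σ' → tangentLift σ t = tangentLift σ' t →
      ∀ᶠ r in 𝓝 t, HasDerivAt (fun s => ((extChartAt (𝓡 2) p (σ' s),
        deriv (fun s => extChartAt (𝓡 2) p (σ' s)) s) : Plane × Plane))
        (geodesicField p (extChartAt (𝓡 2) p (σ' r),
          deriv (fun s => extChartAt (𝓡 2) p (σ' s)) r)) r ∧
        ((extChartAt (𝓡 2) p (σ' r), deriv (fun s => extChartAt (𝓡 2) p (σ' s)) r) :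
          Plane × Plane) ∈ s := by
    intro σ' hσ' h'
    have h1 : σ' t = p := (congrArg TotalSpace.proj h').symm
    have hps' : σ' t ∈ (chartAt Plane p).source := by rw [h1]; exact hps
    have hc := (hσ'.hasDerivAt_geodesicField p hps').continuousAt
    have h2 := hc.preimage_mem_nhds (t := s) (by rw [hstate h1 hσ', ← h']; exact hs)
    filter_upwards [hev hσ' h1, h2] with r hr hr'
    exact ⟨hσ'.hasDerivAt_geodesicField p hr, hr'⟩
  have := ODE_solution_unique_of_eventually (v := fun _ => geodesicField p) (s := fun _ => s)
    (K := K) (.of_forall fun _ => hK) (hmem hσ rfl) (hmem hτ h)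
    (by rw [hstate rfl hσ, hstate hpt hτ, h])
  filter_upwards [this, hev hσ rfl, hev hτ hpt] with r hr h1 h2
  rw [Prod.mk.injEq, hderiv hσ h1, hderiv hτ h2] at hr
  exact coordVec_injOn he h1 ((chartAt Plane p).injOn h1 h2 hr.1) hr.2

/-- A geodesic is determined by its velocity at one time. -/
theorem IsGeodesic.tangentLift_eq [T2Space M] {σ τ : ℝ → M} (hσ : IsGeodesic σ)
    (hτ : IsGeodesic τ) {t : ℝ} (h : tangentLift σ t = tangentLift τ t) :
    tangentLift σ = tangentLift τ := by
  have hcl : IsClosed {t | tangentLift σ t = tangentLift τ t} := by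
    rw [isClosed_iff_frequently]
    intro s hs
    -- In a limit of times of agreement the base points agree because `M` is Hausdorff; a chart at
    -- that point then compares the velocities.
    have hproj : σ s = τ s := by
      have hc : IsClosed {t | σ t = τ t} :=
        isClosed_eq hσ.smooth.continuous hτ.smooth.continuous
      exact isClosed_iff_frequently.1 hc s (hs.mono fun r hr => congrArg TotalSpace.proj hr)
    have he : chartAt Plane (σ s) ∈ IsManifold.maximalAtlas (𝓡 2) ∞ M :=
      IsManifold.chart_mem_maximalAtlas _
    refine coordVec_injOn he (mem_chart_source Plane (σ s)) hproj ?_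
    have hcont : ∀ {τ : ℝ → M}, IsGeodesic τ → σ s = τ s →
        ContinuousAt (fun r => coordVec (chartAt Plane (σ s)) (tangentLift τ r)) s := by
      intro τ hτ h1
      have h2 := (continuousOn_coordVec he).continuousAt (x := tangentLift τ s)
        (((chartAt Plane (σ s)).open_source.preimage
          (FiberBundle.continuous_proj Plane (TangentSpace (𝓡 2)))).mem_nhds
          (show τ s ∈ (chartAt Plane (σ s)).source by
            rw [← h1]; exact mem_chart_source Plane (σ s)))
      exact ContinuousAt.comp (f := tangentLift τ) h2
        (continuous_tangentLift hτ.smooth).continuousAt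
    exact tendsto_nhds_unique_of_frequently_eq (hcont hσ rfl) (hcont hτ hproj)
      (hs.mono fun r hr => by rw [hr])
  have hop : IsOpen {t | tangentLift σ t = tangentLift τ t} :=
    isOpen_iff_mem_nhds.2 fun s hs => hσ.eventuallyEq hτ hs
  have := IsClopen.eq_univ ⟨hcl, hop⟩ ⟨t, h⟩
  exact funext fun s => this.ge (mem_univ s)

theorem tangentLift_comp_neg {σ : ℝ → M} (hσ : ContMDiff 𝓘(ℝ, ℝ) (𝓡 2) ∞ σ) (t : ℝ) :
    tangentLift (fun s => σ (-s)) t = ⟨σ (-t), -velocity σ (-t)⟩ := by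
  have h1 : MDifferentiableAt 𝓘(ℝ, ℝ) (𝓡 2) σ (-t) := (hσ _).mdifferentiableAt (by simp)
  have h2 : HasMFDerivAt 𝓘(ℝ, ℝ) 𝓘(ℝ, ℝ) (fun s : ℝ => -s) t
      (-ContinuousLinearMap.id ℝ ℝ : ℝ →L[ℝ] ℝ) :=
    (hasFDerivAt_id t).neg.hasMFDerivAt
  have h3 := (HasMFDerivAt.comp t h1.hasMFDerivAt h2).mfderiv
  simp only [tangentLift]
  congr 1
  simp only [velocity]
  change mfderiv 𝓘(ℝ, ℝ) (𝓡 2) (σ ∘ fun s => -s) t (1 : ℝ) = _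
  rw [h3]
  change mfderiv 𝓘(ℝ, ℝ) (𝓡 2) σ (-t) (-(1 : ℝ)) = _
  exact map_neg (mfderiv 𝓘(ℝ, ℝ) (𝓡 2) σ (-t)) (1 : ℝ)

/-- The reversed curve of a geodesic is a geodesic. -/
theorem IsGeodesic.comp_neg {σ : ℝ → M} (hσ : IsGeodesic σ) : IsGeodesic (fun t => σ (-t)) where
  smooth := hσ.smooth.comp contDiff_neg.contMDiff
  unit_speed t := by
    have h1 := congrArg (fun v : TangentBundle (𝓡 2) M => ‖v.2‖) (tangentLift_comp_neg hσ.smooth t)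
    have h2 : ‖velocity (fun s => σ (-s)) t‖ = ‖-velocity σ (-t)‖ := h1
    rw [h2, norm_neg, hσ.unit_speed]
  equation p t ht := by
    intro c w
    set d : ℝ → Plane := fun s => extChartAt (𝓡 2) p (σ s) with hd
    have h := hσ.equation p (-t) ht w
    have h1 : deriv c = fun s => -deriv d (-s) := funext fun s => deriv_comp_neg d s
    have h2 : deriv (deriv c) t = deriv (deriv d) (-t) := by
      rw [h1]
      rw [deriv.fun_neg]
      rw [deriv_comp_neg (deriv d), neg_neg]
    rw [h2, h1]
    simp only [christoffel_neg]
    exact h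

end Surface

/-! ### Oriented area and unit vectors in a plane -/

/-- The oriented area spanned by two plane vectors. -/
def cross (a b : Plane) : ℝ := a 0 * b 1 - a 1 * b 0

theorem cross_map (L : Plane →L[ℝ] Plane) (a b : Plane) :
    cross (L a) (L b) = L.det * cross a b := by
  have hdet : L.det = (L (planeBasis 0)) 0 * (L (planeBasis 1)) 1
      - (L (planeBasis 1)) 0 * (L (planeBasis 0)) 1 := by
    rw [ContinuousLinearMap.det,
      ← LinearMap.det_toMatrix (EuclideanSpace.basisFun (Fin 2) ℝ).toBasis,
      Matrix.det_fin_two]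
    simp [LinearMap.toMatrix_apply, planeBasis]
  rw [hdet, plane_eq_smul_add_smul a, plane_eq_smul_add_smul b]
  simp only [cross, map_add, map_smul, PiLp.add_apply, PiLp.smul_apply, smul_eq_mul]
  simp [planeBasis]
  ring

theorem cross_self (a : Plane) : cross a a = 0 := by simp [cross]; ring

theorem cross_neg (a b : Plane) : cross a (-b) = -cross a b := by simp [cross]; ring

theorem eq_smul_of_cross_eq_zero {a b : Plane} (ha : a ≠ 0) (h : cross a b = 0) :
    ∃ k : ℝ, b = k • a := by
  simp only [cross] at h
  by_cases h0 : a 0 = 0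
  · have h1 : a 1 ≠ 0 := fun h1 => ha (by ext i; fin_cases i <;> simp [h0, h1])
    refine ⟨b 1 / a 1, ?_⟩
    ext i; fin_cases i
    · have : b 0 = 0 := by
        rw [h0] at h
        have : a 1 * b 0 = 0 := by linarith
        exact (mul_eq_zero.1 this).resolve_left h1
      simp [h0, this]
    · simp [h1]
  · refine ⟨b 0 / a 0, ?_⟩
    ext i; fin_cases i
    · simp [h0]
    · simp; field_simp; linarith

theorem eq_add_of_cross_ne_zero {a b : Plane} (h : cross a b ≠ 0) (d : Plane) :
    d = (cross d b / cross a b) • a + (cross a d / cross a b) • b := by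
  ext i; fin_cases i
  · simp; field_simp; simp [cross]; ring
  · simp; field_simp; simp [cross]; ring

section Fibre

variable {V : Type*} [NormedAddCommGroup V] [InnerProductSpace ℝ V] {L : V →ₗ[ℝ] Plane}
  {u w w' : V}

theorem eq_or_eq_neg_of_cross_eq_zero (hL : Function.Injective L) (hu : ‖u‖ = 1)
    (hw : ‖w‖ = 1) (h : cross (L u) (L w) = 0) :
    w = u ∨ w = -u := by
  have hu0 : L u ≠ 0 := fun h0 => by
    have : u = 0 := hL (by simpa using h0)
    simp [this] at hu
  obtain ⟨k, hk⟩ := eq_smul_of_cross_eq_zero hu0 h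
  rw [← map_smul] at hk
  have hk := hL hk
  rw [hk, norm_smul, hu, mul_one, Real.norm_eq_abs] at hw
  rcases eq_or_eq_neg_of_abs_eq hw with rfl | rfl
  · exact .inl (by simpa using hk)
  · exact .inr (by simpa using hk)

/-- Write `w' = x u + y w` with `y > 0`, a ratio of oriented areas. The product with `u` and the
length of `w'` give `(1 - c ^ 2) (1 - y ^ 2) = 0`, and `c ^ 2 = 1` would make `w` a multiple of `u`.
The map `L` need not be an isometry: it only tells the sides of `u` apart. -/
theorem eq_of_inner_eq_of_cross_pos (hL : Function.Injective L) (hu : ‖u‖ = 1)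
    (hw : ‖w‖ = 1) (hw' : ‖w'‖ = 1)
    (hi : inner ℝ u w = inner ℝ u w') (h : 0 < cross (L u) (L w))
    (h' : 0 < cross (L u) (L w')) : w = w' := by
  set c := inner ℝ u w with hc
  have hdec := eq_add_of_cross_ne_zero h.ne' (L w')
  set x := cross (L w') (L w) / cross (L u) (L w)
  set y := cross (L u) (L w') / cross (L u) (L w) with hy
  have hy0 : 0 < y := div_pos h' h
  have hw2 : w' = x • u + y • w := hL (by rw [map_add, map_smul, map_smul]; exact hdec)
  have h1 : c = x + y * c := by
    have : inner ℝ u w' = x + y * c := by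
      rw [hw2, inner_add_right, inner_smul_right, inner_smul_right,
        real_inner_self_eq_norm_sq, hu, ← hc]
      ring
    rwa [← hi] at this
  have h2 : (1 : ℝ) = x ^ 2 + 2 * x * y * c + y ^ 2 := by
    have : inner ℝ w' w' = (1 : ℝ) := by rw [real_inner_self_eq_norm_sq, hw']; norm_num
    rw [hw2, inner_add_right, inner_add_left, inner_add_left] at this
    simp only [inner_smul_left, inner_smul_right, real_inner_self_eq_norm_sq, hu, hw,
      real_inner_comm u w, ← hc] at this
    simp at this
    linarith
  have h3 : c ^ 2 ≠ 1 := by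
    intro h3
    have : inner ℝ (w - c • u) (w - c • u) = (0 : ℝ) := by
      rw [inner_sub_right, inner_sub_left, inner_sub_left]
      simp only [inner_smul_left, inner_smul_right, real_inner_self_eq_norm_sq, hu, hw,
        real_inner_comm u w, ← hc]
      simp
      linarith
    rw [inner_self_eq_zero, sub_eq_zero] at this
    rw [this, map_smul] at h
    simp [cross] at h
    linarith
  have h4 : (1 - c ^ 2) * ((1 - y) * (1 + y)) = 0 := by
    have hx : x = c - y * c := by linarith
    rw [hx] at h2
    linarith
  have h5 : y = 1 := by
    rcases mul_eq_zero.1 h4 with h | h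
    · exact absurd (by linarith) h3
    · rcases mul_eq_zero.1 h with h | h <;> linarith
  have h6 : x = 0 := by rw [h5] at h1; linarith
  rw [hw2, h5, h6]
  simp

theorem exists_unit_inner_eq_cross_pos (hL : Function.Injective L) (hL' : Function.Surjective L)
    (hu : ‖u‖ = 1) {c : ℝ} (h1 : -1 < c) (h2 : c < 1) :
    ∃ w : V, ‖w‖ = 1 ∧ inner ℝ u w = c ∧ 0 < cross (L u) (L w) := by
  have hu0 : L u ≠ 0 := fun h0 => by
    have : u = 0 := hL (by simpa using h0)
    simp [this] at hu
  -- Start from a vector whose image is the image of `u` rotated by a right angle, hence on the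
  -- positive side. Making it orthogonal to `u` for the inner product of `V` does not change the
  -- oriented area.
  obtain ⟨m, hm⟩ := hL' !₂[-(L u 1), L u 0]
  have hcr : 0 < cross (L u) (L (m - (inner ℝ u m : ℝ) • u)) := by
    rw [map_sub, map_smul, hm]
    have : 0 < (L u 0) ^ 2 + (L u 1) ^ 2 := by
      by_contra hle
      have h0 : L u 0 = 0 := by nlinarith [sq_nonneg (L u 0), sq_nonneg (L u 1)]
      have h1 : L u 1 = 0 := by nlinarith [sq_nonneg (L u 0), sq_nonneg (L u 1)]
      exact hu0 (by ext i; fin_cases i <;> simp [h0, h1])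
    simp [cross]
    linarith
  set n' := m - (inner ℝ u m : ℝ) • u with hn'
  have hn0 : n' ≠ 0 := by rintro h; rw [h] at hcr; simp [cross] at hcr
  have hin : inner ℝ u n' = (0 : ℝ) := by
    rw [hn', inner_sub_right, inner_smul_right, real_inner_self_eq_norm_sq, hu]; ring
  set s := Real.sqrt (1 - c ^ 2) with hs
  have hs2 : s ^ 2 = 1 - c ^ 2 := Real.sq_sqrt (by nlinarith)
  have hs0 : 0 < s := Real.sqrt_pos.2 (by nlinarith)
  have hnn := norm_pos_iff.2 hn0
  have hiw : inner ℝ u (c • u + (s / ‖n'‖) • n') = c := by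
    rw [inner_add_right, inner_smul_right, inner_smul_right, hin, real_inner_self_eq_norm_sq, hu]
    ring
  refine ⟨c • u + (s / ‖n'‖) • n', ?_, hiw, ?_⟩
  · have : ‖c • u + (s / ‖n'‖) • n'‖ ^ 2 = 1 := by
      rw [← real_inner_self_eq_norm_sq, inner_add_left, inner_smul_left, inner_smul_left, hiw,
        inner_add_right, inner_smul_right, inner_smul_right, real_inner_comm, hin,
        real_inner_self_eq_norm_sq]
      simp
      field_simp
      linarith
    nlinarith [norm_nonneg (c • u + (s / ‖n'‖) • n')]
  · have : cross (L u) (L (c • u + (s / ‖n'‖) • n')) = (s / ‖n'‖) * cross (L u) (L n') := by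
      simp [cross]; ring
    rw [this]
    positivity

end Fibre

/-! ### Polar coordinates on the sphere -/

theorem spherePoint_eq_iff {α β α' β' : ℝ} : spherePoint α β = spherePoint α' β' ↔
    Real.sin α * Real.cos β = Real.sin α' * Real.cos β' ∧
    Real.sin α * Real.sin β = Real.sin α' * Real.sin β' ∧ Real.cos α = Real.cos α' := by
  constructor
  · intro h
    have h' := congrArg (fun y : S2 => y.1) h
    simp only [spherePoint] at h'
    exact ⟨by simpa using congrArg (fun y : EuclideanSpace ℝ (Fin 3) => y 0) h',
      by simpa using congrArg (fun y : EuclideanSpace ℝ (Fin 3) => y 1) h',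
      by simpa using congrArg (fun y : EuclideanSpace ℝ (Fin 3) => y 2) h'⟩
  · rintro ⟨h1, h2, h3⟩
    apply Subtype.ext
    simp only [spherePoint]
    rw [h1, h2, h3]

theorem spherePoint_zero (β : ℝ) : spherePoint 0 β = northPole := by
  rw [northPole, spherePoint_eq_iff]; simp

theorem spherePoint_pi (β : ℝ) : spherePoint Real.pi β = southPole := by
  rw [southPole, spherePoint_eq_iff]; simp

theorem northPole_ne_southPole : northPole ≠ southPole := by
  rw [northPole, southPole, Ne, spherePoint_eq_iff]; simp; norm_num

theorem spherePoint_eq_north {α β : ℝ} (hα : α ∈ Icc 0 Real.pi) (h : spherePoint α β = northPole) :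
    α = 0 := by
  rw [northPole, spherePoint_eq_iff] at h
  exact Real.injOn_cos hα ⟨le_rfl, Real.pi_pos.le⟩ h.2.2

theorem spherePoint_eq_south {α β : ℝ} (hα : α ∈ Icc 0 Real.pi) (h : spherePoint α β = southPole) :
    α = Real.pi := by
  rw [southPole, spherePoint_eq_iff] at h
  exact Real.injOn_cos hα ⟨Real.pi_pos.le, le_rfl⟩ h.2.2

theorem spherePoint_inj {α β α' β' : ℝ} (hα : α ∈ Ioo 0 Real.pi) (hα' : α' ∈ Ioo 0 Real.pi)
    (h : spherePoint α β = spherePoint α' β') : α = α' ∧ ∃ k : ℤ, β' = β + k * (2 * Real.pi) := by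
  rw [spherePoint_eq_iff] at h
  obtain rfl : α = α' := Real.injOn_cos (Ioo_subset_Icc_self hα) (Ioo_subset_Icc_self hα') h.2.2
  have hs := (Real.sin_pos_of_mem_Ioo hα).ne'
  refine ⟨rfl, ?_⟩
  have h1 := mul_left_cancel₀ hs h.1
  have h2 := mul_left_cancel₀ hs h.2.1
  have := Real.Angle.cos_sin_inj h1 h2
  obtain ⟨k, hk⟩ := Real.Angle.angle_eq_iff_two_pi_dvd_sub.1 this.symm
  exact ⟨k, by linarith⟩

theorem continuous_spherePoint : Continuous fun q : ℝ × ℝ => spherePoint q.1 q.2 := by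
  refine Continuous.subtype_mk ?_ _
  refine (PiLp.continuous_toLp 2 _).comp (continuous_pi fun i => ?_)
  fin_cases i <;> simp <;> fun_prop

theorem continuousWithinAt_spherePoint {X : Type*} [TopologicalSpace X] {c b : X → ℝ} {s : Set X}
    {x : X} (hc : ContinuousWithinAt c s x) (hb : ContinuousWithinAt b s x) :
    ContinuousWithinAt (fun x => spherePoint (c x) (b x)) s x :=
  ContinuousAt.comp_continuousWithinAt (g := fun q : ℝ × ℝ => spherePoint q.1 q.2)
    (f := fun x => (c x, b x)) continuous_spherePoint.continuousAt (hc.prodMk hb)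

theorem continuousWithinAt_spherePoint_arccos {X : Type*} [TopologicalSpace X] {c b : X → ℝ}
    {s : Set X} {x : X} (ℓ : ℝ) (hc : ContinuousWithinAt c s x) (hb : ContinuousWithinAt b s x) :
    ContinuousWithinAt (fun x => spherePoint (Real.arccos (c x)) (2 * Real.pi * b x / ℓ)) s x :=
  continuousWithinAt_spherePoint ((Real.continuous_arccos.tendsto (c x)).comp hc)
    ((continuousWithinAt_const.mul hb).div_const ℓ)

theorem exists_spherePoint (y : S2) : ∃ α ∈ Icc 0 Real.pi, ∃ β ∈ Icc (-Real.pi) Real.pi,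
    y = spherePoint α β := by
  have hy : y.1 0 ^ 2 + y.1 1 ^ 2 + y.1 2 ^ 2 = 1 := by
    have := y.2
    rw [mem_sphere_zero_iff_norm, EuclideanSpace.norm_eq, Real.sqrt_eq_one] at this
    simpa [Fin.sum_univ_three] using this
  have h1 : -1 ≤ y.1 2 := by nlinarith [sq_nonneg (y.1 0), sq_nonneg (y.1 1)]
  have h2 : y.1 2 ≤ 1 := by nlinarith [sq_nonneg (y.1 0), sq_nonneg (y.1 1)]
  set z : ℂ := ⟨y.1 0, y.1 1⟩ with hz
  have hnorm : ‖z‖ = Real.sin (Real.arccos (y.1 2)) := by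
    rw [Real.sin_arccos, Complex.norm_eq_sqrt_sq_add_sq]
    congr 1
    simp only [hz]
    linarith
  refine ⟨Real.arccos (y.1 2), ⟨Real.arccos_nonneg _, Real.arccos_le_pi _⟩, Complex.arg z,
    Ioc_subset_Icc_self (Complex.arg_mem_Ioc z), ?_⟩
  apply Subtype.ext
  ext i
  simp only [spherePoint]
  rw [← hnorm, Complex.norm_mul_cos_arg, Complex.norm_mul_sin_arg, Real.cos_arccos h1 h2]
  fin_cases i <;> rfl

/-- The complement of neighbourhoods of the poles is contained in a connected compact set that
avoids the poles. -/
theorem exists_sphere_core {U V : Set S2} (hU : U ∈ 𝓝 northPole) (hV : V ∈ 𝓝 southPole) :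
    ∃ K : Set S2, IsClosed K ∧ IsPreconnected K ∧ K.Nonempty ∧
      northPole ∉ K ∧ southPole ∉ K ∧ ∀ y, y ∈ K ∨ y ∈ U ∨ y ∈ V := by
  have key : ∀ (α₀ : ℝ) (P : S2) (W : Set S2), W ∈ 𝓝 P → (∀ β, spherePoint α₀ β = P) →
      ∀ᶠ α in 𝓝 α₀, ∀ β ∈ Icc (-Real.pi) Real.pi, spherePoint α β ∈ W := by
    intro α₀ P W hW hP
    refine isCompact_Icc.eventually_forall_of_forall_eventually
      (P := fun α β => spherePoint α β ∈ W) fun β _ => ?_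
    exact continuous_spherePoint.continuousAt.preimage_mem_nhds (by rw [hP]; exact hW)
  obtain ⟨δ, hδ, H⟩ := Metric.eventually_nhds_iff.1 (key 0 _ U hU spherePoint_zero)
  obtain ⟨δ', hδ', H'⟩ := Metric.eventually_nhds_iff.1 (key Real.pi _ V hV spherePoint_pi)
  -- The core is a closed band of latitudes. The bounds by `δ / 2` and `δ' / 2` put the caps inside
  -- `U` and `V`, and `η ≤ 1` keeps the colatitude `1` in the band.
  set η := min (min (δ / 2) (δ' / 2)) 1 with hη
  have hη0 : 0 < η := by positivity
  have hη1 : η ≤ δ / 2 := (min_le_left _ _).trans (min_le_left _ _)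
  have hη2 : η ≤ δ' / 2 := (min_le_left _ _).trans (min_le_right _ _)
  have hη3 : η ≤ 1 := min_le_right _ _
  have hpi := Real.pi_gt_three
  refine ⟨(fun q : ℝ × ℝ => spherePoint q.1 q.2) ''
    (Icc η (Real.pi - η) ×ˢ Icc (-Real.pi) Real.pi), ?_, ?_, ?_, ?_, ?_, ?_⟩
  · exact ((isCompact_Icc.prod isCompact_Icc).image continuous_spherePoint).isClosed
  · exact (isPreconnected_Icc.prod isPreconnected_Icc).image _ continuous_spherePoint.continuousOn
  · exact ⟨_, (1, 0), ⟨⟨hη3, by linarith⟩, by linarith, by linarith⟩, rfl⟩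
  · rintro ⟨⟨α, β⟩, ⟨hα, -⟩, h⟩
    have := spherePoint_eq_north ⟨hη0.le.trans hα.1, hα.2.trans (by linarith)⟩ h
    linarith [hα.1]
  · rintro ⟨⟨α, β⟩, ⟨hα, -⟩, h⟩
    have := spherePoint_eq_south ⟨hη0.le.trans hα.1, hα.2.trans (by linarith)⟩ h
    linarith [hα.2]
  · intro y
    obtain ⟨α, hα, β, hβ, rfl⟩ := exists_spherePoint y
    by_cases h1 : α < η
    · refine .inr (.inl (H ?_ β hβ))
      rw [Real.dist_eq, abs_lt]
      constructor <;> linarith [hα.1]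
    by_cases h2 : Real.pi - η < α
    · refine .inr (.inr (H' ?_ β hβ))
      rw [Real.dist_eq, abs_lt]
      constructor <;> linarith [hα.2]
    · exact .inl ⟨(α, β), ⟨⟨not_lt.1 h1, not_lt.1 h2⟩, hβ⟩, rfl⟩

/-! ### Orientation, parameters along `γ`, and the polar map -/

section Surface

variable {M : Type*} [TopologicalSpace M] [ChartedSpace Plane M] [IsManifold (𝓡 2) ∞ M]

theorem coordVec_change {e e' : OpenPartialHomeomorph M Plane}
    (he : e ∈ IsManifold.maximalAtlas (𝓡 2) ∞ M) (he' : e' ∈ IsManifold.maximalAtlas (𝓡 2) ∞ M)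
    {v : TangentBundle (𝓡 2) M} (hv : v.1 ∈ e.source) (hv' : v.1 ∈ e'.source) :
    coordVec e v = fderiv ℝ (e ∘ e'.symm) (e' v.1) (coordVec e' v) := by
  have h1 : MDifferentiableAt (𝓡 2) (𝓡 2) e' v.1 :=
    (contMDiffAt_of_mem_maximalAtlas he' hv').mdifferentiableAt (by simp)
  have h2 : MDifferentiableAt (𝓡 2) (𝓡 2) e'.symm (e' v.1) :=
    (contMDiffAt_symm_of_mem_maximalAtlas he' (e'.map_source hv')).mdifferentiableAt (by simp)
  have h3 : MDifferentiableAt (𝓡 2) (𝓡 2) e (e'.symm (e' v.1)) := by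
    rw [e'.left_inv hv']
    exact (contMDiffAt_of_mem_maximalAtlas he hv).mdifferentiableAt (by simp)
  have h4 : e =ᶠ[𝓝 v.1] (e ∘ e'.symm) ∘ e' := by
    filter_upwards [e'.open_source.mem_nhds hv'] with x hx
    simp [e'.left_inv hx]
  have h5 := h4.mfderiv_eq (I := 𝓡 2) (I' := 𝓡 2)
  rw [mfderiv_comp v.1 (h3.comp _ h2) h1, mfderiv_eq_fderiv] at h5
  exact congrArg (fun L : Plane →L[ℝ] Plane => L v.2) h5

/-- A change of chart multiplies the oriented area by the Jacobian determinant, which is positive in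
an oriented atlas; so any one chart decides. -/
theorem isPositivePair_iff {𝒜 : Set (OpenPartialHomeomorph M Plane)} (h𝒜 : IsOrientedAtlas 𝒜)
    {e : OpenPartialHomeomorph M Plane} (he : e ∈ 𝒜) {x : M} (hx : x ∈ e.source)
    (u w : TangentSpace (𝓡 2) x) :
    IsPositivePair 𝒜 x u w ↔ 0 < cross (coordVec e ⟨x, u⟩) (coordVec e ⟨x, w⟩) := by
  refine ⟨?_, fun h => ⟨e, he, hx, h⟩⟩
  rintro ⟨e', he', hx', h⟩
  rw [coordVec_change (h𝒜.1 he) (h𝒜.1 he') (v := ⟨x, u⟩) hx hx',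
    coordVec_change (h𝒜.1 he) (h𝒜.1 he') (v := ⟨x, w⟩) hx hx', cross_map]
  exact mul_pos (h𝒜.det_pos e' he' e he x ⟨hx', hx⟩) h

theorem coordVec_neg (e : OpenPartialHomeomorph M Plane) (x : M) (u : TangentSpace (𝓡 2) x) :
    coordVec e ⟨x, -u⟩ = -coordVec e ⟨x, u⟩ :=
  map_neg (mfderiv (𝓡 2) (𝓡 2) e x) u

theorem periodic_tangentLift {γ : ℝ → M} {ℓ : ℝ} (hγ : ContMDiff 𝓘(ℝ, ℝ) (𝓡 2) ∞ γ)
    (hp : Function.Periodic γ ℓ) : Function.Periodic (tangentLift γ) ℓ := by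
  intro t
  have he : chartAt Plane (γ t) ∈ IsManifold.maximalAtlas (𝓡 2) ∞ M :=
    IsManifold.chart_mem_maximalAtlas _
  have ht := mem_chart_source Plane (γ t)
  refine coordVec_injOn he (show γ (t + ℓ) ∈ _ by rwa [hp t]) (hp t) ?_
  have h1 := hasDerivAt_chart_comp he hγ ht
  have h2 := (hasDerivAt_chart_comp he hγ (show γ (t + ℓ) ∈ _ by rwa [hp t])).comp_add_const t ℓ
  simp only [hp _] at h2
  exact h2.unique h1

theorem eq_add_int_mul_of_eq {γ : ℝ → M} {ℓ : ℝ} (hℓ : 0 < ℓ) (hp : Function.Periodic γ ℓ)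
    (hs : InjOn γ (Ico 0 ℓ)) {t t' : ℝ} (h : γ t = γ t') : ∃ k : ℤ, t' = t + k * ℓ := by
  have h1 : ∀ t, γ (toIcoMod hℓ 0 t) = γ t := fun t =>
    hp.sub_zsmul_eq _
  have h2 : ∀ t, toIcoMod hℓ 0 t ∈ Ico 0 ℓ := fun t => by
    simpa using toIcoMod_mem_Ico hℓ 0 t
  have h3 := hs (h2 t) (h2 t') (by rw [h1, h1, h])
  refine ⟨toIcoDiv hℓ 0 t' - toIcoDiv hℓ 0 t, ?_⟩
  rw [toIcoMod, toIcoMod, zsmul_eq_mul, zsmul_eq_mul] at h3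
  push_cast
  linarith

/-- Choose parameters in a window of length `ℓ` centred at `t₀`. Only the two ends of the window
share an image, and this is not `γ t₀`; the parameters away from `t₀` therefore have compact image
missing `γ t₀`, which gives continuity at this one point. -/
theorem exists_local_parameter [T2Space M] {γ : ℝ → M} {ℓ : ℝ} (hc : Continuous γ) (hℓ : 0 < ℓ)
    (hp : Function.Periodic γ ℓ) (hs : InjOn γ (Ico 0 ℓ)) (t₀ : ℝ) :
    ∃ β : M → ℝ, (∀ x ∈ range γ, γ (β x) = x) ∧ β (γ t₀) = t₀ ∧
      Tendsto β (𝓝[range γ] (γ t₀)) (𝓝 t₀) := by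
  classical
  have hex : ∀ x ∈ range γ, ∃ t ∈ Icc (t₀ - ℓ / 2) (t₀ + ℓ / 2), γ t = x := by
    rintro _ ⟨t, rfl⟩
    refine ⟨toIcoMod hℓ (t₀ - ℓ / 2) t, ?_, hp.sub_zsmul_eq _⟩
    have := toIcoMod_mem_Ico hℓ (t₀ - ℓ / 2) t
    exact ⟨this.1, by linarith [this.2]⟩
  have huniq : ∀ t ∈ Icc (t₀ - ℓ / 2) (t₀ + ℓ / 2), γ t = γ t₀ → t = t₀ := by
    intro t ht h
    obtain ⟨k, hk⟩ := eq_add_int_mul_of_eq hℓ hp hs h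
    have h1 : (k : ℝ) < 1 := by by_contra! h1; nlinarith [ht.1]
    have h2 : (-1 : ℝ) < k := by by_contra! h1; nlinarith [ht.2]
    have h3 : k = 0 := by
      have h1' : k < 1 := by exact_mod_cast h1
      have h2' : -1 < k := by exact_mod_cast h2
      omega
    simp [h3] at hk
    exact hk.symm
  choose! β hβ using hex
  refine ⟨β, fun x hx => (hβ x hx).2, huniq _ (hβ _ ⟨t₀, rfl⟩).1 (hβ _ ⟨t₀, rfl⟩).2, ?_⟩
  intro U hU
  obtain ⟨O, hOU, hO, hOt⟩ := mem_nhds_iff.1 hU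
  have hcl : IsClosed (γ '' (Icc (t₀ - ℓ / 2) (t₀ + ℓ / 2) \ O)) :=
    ((isCompact_Icc.diff hO).image hc).isClosed
  have hnot : γ t₀ ∉ γ '' (Icc (t₀ - ℓ / 2) (t₀ + ℓ / 2) \ O) := by
    rintro ⟨t, ht, h⟩
    exact ht.2 (huniq t ht.1 h ▸ hOt)
  rw [mem_map]
  filter_upwards [mem_nhdsWithin_of_mem_nhds (hcl.isOpen_compl.mem_nhds hnot),
    self_mem_nhdsWithin] with x hx hxr
  by_contra hno
  exact hx ⟨β x, ⟨(hβ x hxr).1, fun h => hno (hOU h)⟩, (hβ x hxr).2⟩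

variable [RiemannianBundle (fun x : M => TangentSpace (𝓡 2) x)]

theorem angle_eq_of_totalSpace_eq {x x' : M} {u w : TangentSpace (𝓡 2) x}
    {u' w' : TangentSpace (𝓡 2) x'} (hu : (⟨x, u⟩ : TangentBundle (𝓡 2) M) = ⟨x', u'⟩)
    (hw : (⟨x, w⟩ : TangentBundle (𝓡 2) M) = ⟨x', w'⟩) :
    InnerProductGeometry.angle u w = InnerProductGeometry.angle u' w' := by
  obtain rfl : x = x' := congrArg TotalSpace.proj hu
  cases hu
  cases hw
  rfl

theorem IsSimpleClosedGeodesic.tangentLift_eq_of_eq {γ : ℝ → M} {ℓ : ℝ}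
    (hγ : IsSimpleClosedGeodesic γ ℓ) {t t' : ℝ} (h : γ t = γ t') :
    tangentLift γ t = tangentLift γ t' := by
  obtain ⟨k, rfl⟩ := eq_add_int_mul_of_eq hγ.length_pos hγ.periodic hγ.simple h
  exact ((periodic_tangentLift hγ.geodesic.smooth hγ.periodic).int_mul k t).symm

theorem IsSimpleClosedGeodesic.spherePoint_eq_of_eq {γ : ℝ → M} {ℓ : ℝ}
    (hγ : IsSimpleClosedGeodesic γ ℓ) {t t' : ℝ} (h : γ t = γ t') (α : ℝ) :
    spherePoint α (2 * Real.pi * t / ℓ) = spherePoint α (2 * Real.pi * t' / ℓ) := by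
  obtain ⟨k, rfl⟩ := eq_add_int_mul_of_eq hγ.length_pos hγ.periodic hγ.simple h
  have hℓ := hγ.length_pos.ne'
  have : 2 * Real.pi * (t + k * ℓ) / ℓ = 2 * Real.pi * t / ℓ + k * (2 * Real.pi) := by
    field_simp
  rw [this, spherePoint_eq_iff, Real.cos_add_int_mul_two_pi, Real.sin_add_int_mul_two_pi]
  exact ⟨rfl, rfl, rfl⟩

open Classical in
/-- The extension of `annulusToSphere` to all unit vectors along `γ`: the vector at `γ t` making
the angle `α` with the velocity of `γ` goes to the point of colatitude `α` and longitude
`2 π t / ℓ`. -/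
def polarMap (γ : ℝ → M) (ℓ : ℝ) (v : UnitTangent M) : S2 :=
  if h : ∃ (t : ℝ) (w : TangentSpace (𝓡 2) (γ t)), v.1 = ⟨γ t, w⟩ then
    spherePoint (InnerProductGeometry.angle (velocity γ h.choose) h.choose_spec.choose)
      (2 * Real.pi * h.choose / ℓ)
  else northPole

/-- Independence of the chosen representation: parameters of the same point differ by a multiple of
`ℓ`, which changes neither the velocity of `γ` nor the longitude modulo `2 π`. -/
theorem spherePoint_angle_eq {γ : ℝ → M} {ℓ : ℝ}
    (hγ : IsSimpleClosedGeodesic γ ℓ) {v : UnitTangent M} {t t' : ℝ} {w : TangentSpace (𝓡 2) (γ t)}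
    {w' : TangentSpace (𝓡 2) (γ t')} (h : v.1 = ⟨γ t, w⟩) (h' : v.1 = ⟨γ t', w'⟩) :
    spherePoint (InnerProductGeometry.angle (velocity γ t) w) (2 * Real.pi * t / ℓ) =
      spherePoint (InnerProductGeometry.angle (velocity γ t') w') (2 * Real.pi * t' / ℓ) := by
  have h1 : γ t = γ t' := congrArg TotalSpace.proj (h.symm.trans h')
  rw [angle_eq_of_totalSpace_eq (hγ.tangentLift_eq_of_eq h1) (h.symm.trans h'),
    hγ.spherePoint_eq_of_eq h1]

theorem polarMap_eq {γ : ℝ → M} {ℓ : ℝ} (hγ : IsSimpleClosedGeodesic γ ℓ) {v : UnitTangent M}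
    {t : ℝ} {w : TangentSpace (𝓡 2) (γ t)} (h : v.1 = ⟨γ t, w⟩) :
    polarMap γ ℓ v =
      spherePoint (InnerProductGeometry.angle (velocity γ t) w) (2 * Real.pi * t / ℓ) := by
  have hex : ∃ (t : ℝ) (w : TangentSpace (𝓡 2) (γ t)), v.1 = ⟨γ t, w⟩ := ⟨t, w, h⟩
  rw [polarMap, dif_pos hex]
  exact spherePoint_angle_eq hγ hex.choose_spec.choose_spec h

theorem annulusToSphere_eq_polarMap {𝒜 : Set (OpenPartialHomeomorph M Plane)} {γ : ℝ → M} {ℓ : ℝ}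
    (hγ : IsSimpleClosedGeodesic γ ℓ) (v : annulus 𝒜 γ) :
    annulusToSphere 𝒜 γ ℓ v = polarMap γ ℓ v :=
  (polarMap_eq hγ v.2.choose_spec.choose_spec.1).symm

end Surface

/-! ### Topology of the annulus and continuity of the polar map -/

section Surface

variable {M : Type*} [TopologicalSpace M] [ChartedSpace Plane M] [IsManifold (𝓡 2) ∞ M]
  [RiemannianBundle (fun x : M => TangentSpace (𝓡 2) x)]
  [IsContMDiffRiemannianBundle (𝓡 2) ∞ Plane (fun x : M => TangentSpace (𝓡 2) x)]

theorem exists_eq_mk {v : TangentBundle (𝓡 2) M} {x : M} (h : x = v.1) :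
    ∃ w : TangentSpace (𝓡 2) x, v = ⟨x, w⟩ := by
  subst h; exact ⟨v.2, rfl⟩

/-- A tangent vector at `y`, regarded as a tangent vector at `x`; only meaningful if `x = y`. -/
def transportVec (x : M) {y : M} (w : TangentSpace (𝓡 2) y) : TangentSpace (𝓡 2) x := w

theorem mk_transportVec {x y : M} (h : y = x) (w : TangentSpace (𝓡 2) y) :
    (⟨x, transportVec x w⟩ : TangentBundle (𝓡 2) M) = ⟨y, w⟩ := by
  subst h; rfl

/-- The unit vectors based at points of the curve `γ`. -/
def unitAlong (γ : ℝ → M) : Set (UnitTangent M) := {v | v.1.proj ∈ range γ}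

theorem continuous_unitTangent_proj : Continuous fun v : UnitTangent M => v.1.proj :=
  (FiberBundle.continuous_proj Plane (TangentSpace (𝓡 2))).comp continuous_subtype_val

theorem IsSimpleClosedGeodesic.isClosed_range [T2Space M] {γ : ℝ → M} {ℓ : ℝ}
    (hγ : IsSimpleClosedGeodesic γ ℓ) : IsClosed (range γ) := by
  rw [← hγ.periodic.image_Icc hγ.length_pos 0]
  exact (isCompact_Icc.image hγ.geodesic.smooth.continuous).isClosed

theorem IsSimpleClosedGeodesic.isClosed_unitAlong [T2Space M] {γ : ℝ → M} {ℓ : ℝ}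
    (hγ : IsSimpleClosedGeodesic γ ℓ) : IsClosed (unitAlong γ) :=
  hγ.isClosed_range.preimage continuous_unitTangent_proj

theorem tendsto_proj {γ : ℝ → M} (v₀ : UnitTangent M) :
    Tendsto (fun v : UnitTangent M => v.1.proj) (𝓝[unitAlong γ] v₀) (𝓝[range γ] v₀.1.proj) :=
  tendsto_nhdsWithin_iff.2 ⟨continuous_unitTangent_proj.continuousAt.mono_left nhdsWithin_le_nhds,
    self_mem_nhdsWithin⟩

section Orientation

variable {𝒜 : Set (OpenPartialHomeomorph M Plane)} {γ : ℝ → M} {ℓ : ℝ}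

/-- The closure of the annulus: it contains also the vectors tangent to `γ`. -/
def closedAnnulus (𝒜 : Set (OpenPartialHomeomorph M Plane)) (γ : ℝ → M) : Set (UnitTangent M) :=
  {v | v ∈ annulus 𝒜 γ ∨ ∃ t, v.1 = tangentLift γ t ∨ v.1 = ⟨γ t, -velocity γ t⟩}

theorem annulus_subset_unitAlong : annulus 𝒜 γ ⊆ unitAlong γ := by
  rintro v ⟨t, w, h, -⟩
  exact ⟨t, (congrArg TotalSpace.proj h).symm⟩

theorem closedAnnulus_subset_unitAlong : closedAnnulus 𝒜 γ ⊆ unitAlong γ := by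
  rintro v (hv | ⟨t, h | h⟩)
  · exact annulus_subset_unitAlong hv
  · exact ⟨t, (congrArg TotalSpace.proj h).symm⟩
  · exact ⟨t, (congrArg TotalSpace.proj h).symm⟩

/-- The oriented area in the chart `e` of the velocity of `γ` at `t` and `v`. -/
def sideFun (e : OpenPartialHomeomorph M Plane) (γ : ℝ → M) (t : ℝ) (v : UnitTangent M) : ℝ :=
  cross (coordVec e (tangentLift γ t)) (coordVec e v.1)

theorem mem_annulus_iff (h𝒜 : IsOrientedAtlas 𝒜) (hγ : IsSimpleClosedGeodesic γ ℓ)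
    {e : OpenPartialHomeomorph M Plane} (he : e ∈ 𝒜)
    {v : UnitTangent M} {t : ℝ} (ht : γ t = v.1.proj) (hv : v.1.proj ∈ e.source) :
    v ∈ annulus 𝒜 γ ↔ 0 < sideFun e γ t v := by
  have hs : γ t ∈ e.source := ht ▸ hv
  constructor
  · rintro ⟨t', w, h, hpos⟩
    have h1 : γ t = γ t' := ht.trans (congrArg TotalSpace.proj h)
    rw [isPositivePair_iff h𝒜 he (h1 ▸ hs)] at hpos
    rw [sideFun, hγ.tangentLift_eq_of_eq h1, h]
    exact hpos
  · intro hpos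
    obtain ⟨w, hw⟩ := exists_eq_mk ht
    refine ⟨t, w, hw, ?_⟩
    rw [isPositivePair_iff h𝒜 he hs]
    rw [sideFun, hw] at hpos
    exact hpos

theorem mem_closedAnnulus_iff (h𝒜 : IsOrientedAtlas 𝒜) (hγ : IsSimpleClosedGeodesic γ ℓ)
    {e : OpenPartialHomeomorph M Plane} (he : e ∈ 𝒜)
    {v : UnitTangent M} {t : ℝ} (ht : γ t = v.1.proj) (hv : v.1.proj ∈ e.source) :
    v ∈ closedAnnulus 𝒜 γ ↔ 0 ≤ sideFun e γ t v := by
  have hs : γ t ∈ e.source := ht ▸ hv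
  constructor
  · rintro (h | ⟨t', h | h⟩)
    · exact ((mem_annulus_iff h𝒜 hγ he ht hv).1 h).le
    · have h1 : γ t = γ t' := ht.trans (congrArg TotalSpace.proj h)
      rw [sideFun, hγ.tangentLift_eq_of_eq h1, h, cross_self]
    · have h1 : γ t = γ t' := ht.trans (congrArg TotalSpace.proj h)
      rw [sideFun, hγ.tangentLift_eq_of_eq h1, h, coordVec_neg, cross_neg, tangentLift, cross_self,
        neg_zero]
  · intro h
    rcases h.lt_or_eq with h | h
    · exact .inl ((mem_annulus_iff h𝒜 hγ he ht hv).2 h)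
    · obtain ⟨w, hw⟩ := exists_eq_mk ht
      have hw1 : ‖w‖ = 1 := by
        have := v.2
        rw [hw] at this
        exact this
      rw [sideFun, hw] at h
      -- Zero area makes the unit vector parallel to the velocity of `γ`, so it lies on one of the
      -- two boundary circles.
      rcases eq_or_eq_neg_of_cross_eq_zero
        (L := (mfderiv (𝓡 2) (𝓡 2) e (γ t)).toLinearMap)
        (injective_mfderiv_chart (h𝒜.1 he) hs)
        (hγ.geodesic.unit_speed t) hw1 h.symm with h | h
      · exact .inr ⟨t, .inl (by rw [hw, h]; rfl)⟩
      · exact .inr ⟨t, .inr (by rw [hw, h])⟩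

theorem continuousWithinAt_sideFun (h𝒜 : IsOrientedAtlas 𝒜) (hγ : IsSimpleClosedGeodesic γ ℓ)
    {e : OpenPartialHomeomorph M Plane} (he : e ∈ 𝒜) {v₀ : UnitTangent M} {t₀ : ℝ}
    (ht : γ t₀ = v₀.1.proj) (hv : v₀.1.proj ∈ e.source) {β : M → ℝ} (hβ₀ : β (γ t₀) = t₀)
    (hβ : Tendsto β (𝓝[range γ] (γ t₀)) (𝓝 t₀)) :
    ContinuousWithinAt (fun v : UnitTangent M => sideFun e γ (β v.1.proj) v) (unitAlong γ) v₀ := by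
  have ho : ∀ v : TangentBundle (𝓡 2) M, v.1 ∈ e.source → ContinuousAt (coordVec e) v := fun v hv =>
    (continuousOn_coordVec (h𝒜.1 he)).continuousAt ((e.open_source.preimage
      (FiberBundle.continuous_proj Plane (TangentSpace (𝓡 2)))).mem_nhds hv)
  have h1 : ContinuousWithinAt (fun v : UnitTangent M => coordVec e v.1) (unitAlong γ) v₀ :=
    ((ho _ hv).comp (f := Subtype.val) continuous_subtype_val.continuousAt).continuousWithinAt
  have h2 : ContinuousWithinAt (fun v : UnitTangent M => coordVec e (tangentLift γ (β v.1.proj)))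
      (unitAlong γ) v₀ := by
    have h3 : ContinuousAt (fun t => coordVec e (tangentLift γ t)) t₀ :=
      ContinuousAt.comp (f := tangentLift γ) (ho _ (show γ t₀ ∈ _ from ht ▸ hv))
        (continuous_tangentLift hγ.geodesic.smooth).continuousAt
    have h4 : Tendsto (fun v : UnitTangent M => β v.1.proj) (𝓝[unitAlong γ] v₀) (𝓝 t₀) :=
      hβ.comp (ht ▸ tendsto_proj v₀)
    have h5 := h3.tendsto.comp h4
    rw [ContinuousWithinAt, ← ht, hβ₀]
    exact h5
  simp only [sideFun, cross]
  have hc : ∀ i : Fin 2, Continuous fun a : Plane => a i := fun i => by fun_prop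
  exact (((hc 0).continuousAt.comp_continuousWithinAt h2).mul
    ((hc 1).continuousAt.comp_continuousWithinAt h1)).sub
    (((hc 1).continuousAt.comp_continuousWithinAt h2).mul
    ((hc 0).continuousAt.comp_continuousWithinAt h1))

/-- Among the vectors along `γ`, being strictly on the right is an open condition; all other vectors
are excluded because the image of `γ` is closed. -/
theorem isClosed_closedAnnulus [T2Space M] (h𝒜 : IsOrientedAtlas 𝒜)
    (hγ : IsSimpleClosedGeodesic γ ℓ) : IsClosed (closedAnnulus 𝒜 γ) := by
  rw [← isOpen_compl_iff, isOpen_iff_mem_nhds]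
  intro v₀ hv₀
  by_cases hT : v₀ ∈ unitAlong γ
  · obtain ⟨t₀, ht⟩ := hT
    obtain ⟨e, he, hs⟩ := h𝒜.covers v₀.1.proj
    obtain ⟨β, hβ1, hβ0, hβ⟩ := exists_local_parameter hγ.geodesic.smooth.continuous
      hγ.length_pos hγ.periodic hγ.simple t₀
    rw [mem_compl_iff, mem_closedAnnulus_iff h𝒜 hγ he ht hs, not_le] at hv₀
    have hc := continuousWithinAt_sideFun h𝒜 hγ he ht hs hβ0 hβ
    have h1 : ∀ᶠ v in 𝓝[unitAlong γ] v₀, sideFun e γ (β v.1.proj) v < 0 := by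
      refine hc.eventually (gt_mem_nhds ?_)
      beta_reduce
      rwa [← ht, hβ0]
    have h2 : ∀ᶠ v : UnitTangent M in 𝓝 v₀, v.1.proj ∈ e.source :=
      continuous_unitTangent_proj.continuousAt.preimage_mem_nhds (e.open_source.mem_nhds hs)
    filter_upwards [eventually_nhdsWithin_iff.1 h1, h2] with v h3 h4 hvB
    have hvT := closedAnnulus_subset_unitAlong hvB
    have := (mem_closedAnnulus_iff h𝒜 hγ he (hβ1 _ hvT) h4).1 hvB
    linarith [h3 hvT]
  · exact mem_of_superset (hγ.isClosed_unitAlong.isOpen_compl.mem_nhds hT)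
      (compl_subset_compl.2 closedAnnulus_subset_unitAlong)

/-- Near a vector of the annulus, membership in the annulus reduces to having the base point on `γ`,
a condition on the surface alone. -/
theorem eventually_mem_annulus [T2Space M] (h𝒜 : IsOrientedAtlas 𝒜)
    (hγ : IsSimpleClosedGeodesic γ ℓ) {v₀ : UnitTangent M} (hv₀ : v₀ ∈ annulus 𝒜 γ) :
    ∀ᶠ v in 𝓝 v₀, v ∈ unitAlong γ → v ∈ annulus 𝒜 γ := by
  obtain ⟨t₀, ht⟩ := annulus_subset_unitAlong hv₀
  obtain ⟨e, he, hs⟩ := h𝒜.covers v₀.1.proj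
  obtain ⟨β, hβ1, hβ0, hβ⟩ := exists_local_parameter hγ.geodesic.smooth.continuous
    hγ.length_pos hγ.periodic hγ.simple t₀
  rw [mem_annulus_iff h𝒜 hγ he ht hs] at hv₀
  have hc := continuousWithinAt_sideFun h𝒜 hγ he ht hs hβ0 hβ
  have h1 : ∀ᶠ v in 𝓝[unitAlong γ] v₀, 0 < sideFun e γ (β v.1.proj) v := by
    refine hc.eventually (lt_mem_nhds ?_)
    beta_reduce
    rwa [← ht, hβ0]
  have h2 : ∀ᶠ v : UnitTangent M in 𝓝 v₀, v.1.proj ∈ e.source :=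
    continuous_unitTangent_proj.continuousAt.preimage_mem_nhds (e.open_source.mem_nhds hs)
  filter_upwards [eventually_nhdsWithin_iff.1 h1, h2] with v h3 h4 hvT
  exact (mem_annulus_iff h𝒜 hγ he (hβ1 _ hvT) h4).2 (h3 hvT)

theorem continuousOn_polarMap [T2Space M] (hγ : IsSimpleClosedGeodesic γ ℓ) :
    ContinuousOn (polarMap γ ℓ) (unitAlong γ) := by
  intro v₀ hv₀
  obtain ⟨t₀, ht⟩ := hv₀
  obtain ⟨β, hβ1, hβ0, hβ⟩ := exists_local_parameter hγ.geodesic.smooth.continuous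
    hγ.length_pos hγ.periodic hγ.simple t₀
  have hβc : ContinuousWithinAt (fun v : UnitTangent M => β v.1.proj) (unitAlong γ) v₀ := by
    rw [ContinuousWithinAt, ← ht, hβ0]
    exact hβ.comp (ht ▸ tendsto_proj v₀)
  -- The velocity of `γ` is regarded as a vector in the fibre over the base point of `v`, so that
  -- the inner product of the two can be formed and is continuous.
  have hlift : ContinuousWithinAt (fun v : UnitTangent M => (⟨v.1.proj,
      transportVec v.1.proj (velocity γ (β v.1.proj))⟩ : TangentBundle (𝓡 2) M))
      (unitAlong γ) v₀ := by
    have h1 := (continuous_tangentLift hγ.geodesic.smooth).continuousAt.comp_continuousWithinAt hβc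
    exact h1.congr (fun v hv => mk_transportVec (hβ1 _ hv) _)
      (mk_transportVec (hβ1 _ ⟨t₀, ht⟩) _)
  have hin : ContinuousWithinAt (fun v : UnitTangent M =>
      (inner ℝ (transportVec v.1.proj (velocity γ (β v.1.proj))) v.1.2 : ℝ))
      (unitAlong γ) v₀ :=
    ContinuousWithinAt.inner_bundle (F := Plane) (E := fun x : M => TangentSpace (𝓡 2) x)
      (b := fun v : UnitTangent M => v.1.proj) hlift continuous_subtype_val.continuousWithinAt
  have heq : ∀ v ∈ unitAlong γ, polarMap γ ℓ v = spherePoint (Real.arccos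
      (inner ℝ (transportVec v.1.proj (velocity γ (β v.1.proj))) v.1.2))
      (2 * Real.pi * β v.1.proj / ℓ) := by
    intro v hv
    obtain ⟨w, hw⟩ := exists_eq_mk (hβ1 _ hv)
    have h1 := mk_transportVec (hβ1 _ hv) (velocity γ (β v.1.proj))
    have h2 := angle_eq_of_totalSpace_eq h1 (w := v.1.2) (w' := w) hw
    have h3 : ‖transportVec v.1.proj (velocity γ (β v.1.proj))‖ = 1 := by
      have h4 : ‖(⟨v.1.proj, transportVec v.1.proj (velocity γ (β v.1.proj))⟩ :
        TangentBundle (𝓡 2) M).2‖ = 1 := by rw [h1]; exact hγ.geodesic.unit_speed _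
      exact h4
    rw [polarMap_eq hγ hw, ← h2, InnerProductGeometry.angle, h3, v.2]
    simp
  exact (continuousWithinAt_spherePoint_arccos ℓ hin hβc).congr heq (heq v₀ ⟨t₀, ht⟩)

end Orientation
end Surface

/-! ### Local equations of curves, and flow boxes -/

/-- The linear form `b ↦ cross a b`. -/
def crossL (a : Plane) : Plane →L[ℝ] ℝ :=
  a 0 • EuclideanSpace.proj (1 : Fin 2) - a 1 • EuclideanSpace.proj (0 : Fin 2)

theorem crossL_apply (a b : Plane) : crossL a b = cross a b := by simp [crossL, cross]

/-- The linear form `b ↦ a · b`. -/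
def dotL (a : Plane) : Plane →L[ℝ] ℝ :=
  a 0 • EuclideanSpace.proj (0 : Fin 2) + a 1 • EuclideanSpace.proj (1 : Fin 2)

theorem dotL_apply (a b : Plane) : dotL a b = a 0 * b 0 + a 1 * b 1 := by simp [dotL]

theorem dotL_self_pos {a : Plane} (ha : a ≠ 0) : 0 < dotL a a := by
  rw [dotL_apply]
  by_contra hle
  have h0 : a 0 = 0 := by nlinarith [mul_self_nonneg (a 0), mul_self_nonneg (a 1)]
  have h1 : a 1 = 0 := by nlinarith [mul_self_nonneg (a 0), mul_self_nonneg (a 1)]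
  exact ha (by ext i; fin_cases i <;> simp [h0, h1])

theorem eq_of_dotL_crossL {a x y : Plane} (ha : a ≠ 0) (h1 : dotL a x = dotL a y)
    (h2 : crossL a x = crossL a y) : x = y := by
  have hpos := dotL_self_pos ha
  rw [dotL_apply] at hpos
  rw [dotL_apply, dotL_apply] at h1
  rw [crossL_apply, crossL_apply, cross, cross] at h2
  have e0 : (a 0 * a 0 + a 1 * a 1) * (x 0 - y 0) = 0 := by
    linear_combination a 0 * h1 - a 1 * h2
  have e1 : (a 0 * a 0 + a 1 * a 1) * (x 1 - y 1) = 0 := by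
    linear_combination a 1 * h1 + a 0 * h2
  have f0 := (mul_eq_zero.1 e0).resolve_left hpos.ne'
  have f1 := (mul_eq_zero.1 e1).resolve_left hpos.ne'
  ext i; fin_cases i
  · exact sub_eq_zero.1 f0
  · exact sub_eq_zero.1 f1

/-- A regular plane curve is locally the zero set of a `C¹` function with nonzero differential. -/
theorem exists_local_defining_function {c : ℝ → Plane} {t₀ : ℝ} {a : Plane}
    (hc : ContDiffAt ℝ 1 c t₀) (ha : HasDerivAt c a t₀) (h0 : a ≠ 0) :
    ∃ f : Plane → ℝ, ContDiffAt ℝ 1 f (c t₀) ∧ (∀ b, fderiv ℝ f (c t₀) b = cross a b) ∧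
      (∀ᶠ t in 𝓝 t₀, f (c t) = 0) ∧
      ∀ U ∈ 𝓝 t₀, ∀ᶠ x in 𝓝 (c t₀), f x = 0 → ∃ t ∈ U, c t = x := by
  have hh : ContDiffAt ℝ 1 (fun t => dotL a (c t)) t₀ := (dotL a).contDiff.contDiffAt.comp t₀ hc
  have hh' : HasDerivAt (fun t => dotL a (c t)) (dotL a a) t₀ :=
    (dotL a).hasFDerivAt.comp_hasDerivAt t₀ ha
  have hk : ContDiffAt ℝ 1 (fun t => crossL a (c t)) t₀ :=
    (crossL a).contDiff.contDiffAt.comp t₀ hc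
  have hk' : HasDerivAt (fun t => crossL a (c t)) 0 t₀ := by
    have := (crossL a).hasFDerivAt.comp_hasDerivAt t₀ ha
    rwa [crossL_apply, cross_self] at this
  -- The component of the curve along `a` has derivative `a · a ≠ 0`, so it has a local inverse `g`
  -- and the curve is a graph over the direction `a`. The function below measures the deviation from
  -- this graph in the transverse direction.
  have heq := hh'.hasFDerivAt_equiv (dotL_self_pos h0).ne'
  set g := hh.localInverse heq one_ne_zero with hg
  have hgc : ContDiffAt ℝ 1 g (dotL a (c t₀)) := hh.to_localInverse heq one_ne_zero
  have hg0 : g (dotL a (c t₀)) = t₀ := hh.localInverse_apply_image heq one_ne_zero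
  have hs := hh.hasStrictFDerivAt' heq one_ne_zero
  have hleft : ∀ᶠ t in 𝓝 t₀, g (dotL a (c t)) = t := hs.eventually_left_inverse
  have hright : ∀ᶠ y in 𝓝 (dotL a (c t₀)), dotL a (c (g y)) = y := hs.eventually_right_inverse
  have hgL : ContDiffAt ℝ 1 (fun x => g (dotL a x)) (c t₀) :=
    ContDiffAt.comp (c t₀) hgc (dotL a).contDiff.contDiffAt
  have hkg : ContDiffAt ℝ 1 (fun x => crossL a (c (g (dotL a x)))) (c t₀) :=
    ContDiffAt.comp (g := fun t => crossL a (c t)) (f := fun x => g (dotL a x)) (c t₀)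
      (by rw [hg0]; exact hk) hgL
  refine ⟨fun x => crossL a x - crossL a (c (g (dotL a x))),
    (crossL a).contDiff.contDiffAt.sub hkg, fun b => ?_, ?_, fun U hU => ?_⟩
  · have h1 := (hgL.differentiableAt one_ne_zero).hasFDerivAt
    -- The graph is tangent to `a` at the base point, so its height contributes nothing to the
    -- differential.
    have h2 : HasFDerivAt (fun x => crossL a (c (g (dotL a x)))) (0 : Plane →L[ℝ] ℝ) (c t₀) := by
      have := HasDerivAt.comp_hasFDerivAt (h₂ := fun t => crossL a (c t)) (c t₀)
        (by rw [hg0]; exact hk') h1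
      rw [zero_smul] at this
      exact this
    have h3 : HasFDerivAt (fun x => crossL a x - crossL a (c (g (dotL a x)))) (crossL a - 0)
        (c t₀) := (crossL a).hasFDerivAt.sub h2
    rw [h3.fderiv, sub_zero, crossL_apply]
  · filter_upwards [hleft] with t ht
    rw [ht, sub_self]
  · have hgt : Tendsto (fun x => g (dotL a x)) (𝓝 (c t₀)) (𝓝 t₀) := by
      have := hgL.continuousAt.tendsto
      rwa [hg0] at this
    filter_upwards [hgt hU, (dotL a).continuous.continuousAt.eventually hright] with x hx1 hx2 hx3
    exact ⟨_, hx1, eq_of_dotL_crossL h0 hx2 (sub_eq_zero.1 hx3).symm⟩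

section FlowBox

variable {X : Type*} [TopologicalSpace X] {Φ : Flow ℝ X} {A W : Set X} {v₀ : X} {φ : X → ℝ}

theorem exists_flow_mem (hW : W ∈ 𝓝 v₀) : ∃ ε > 0, ∀ᶠ u in 𝓝 v₀, ∀ s, |s| < ε → Φ s u ∈ W := by
  have hΦ : Continuous fun q : X × ℝ => Φ q.2 q.1 := Φ.continuous continuous_snd continuous_fst
  have h1 : (fun q : X × ℝ => Φ q.2 q.1) ⁻¹' W ∈ 𝓝 (v₀, (0 : ℝ)) :=
    hΦ.continuousAt.preimage_mem_nhds (by simpa using hW)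
  rw [nhds_prod_eq] at h1
  obtain ⟨U, hU, I, hI, hUI⟩ := mem_prod_iff.1 h1
  obtain ⟨ε, hε, hεI⟩ := Metric.mem_nhds_iff.1 hI
  refine ⟨ε, hε, ?_⟩
  filter_upwards [hU] with u hu s hs
  exact hUI (mk_mem_prod hu (hεI (by simpa using hs)))

theorem strictMonoOn_flow (hder : ∀ u ∈ W, ∃ d > 0, HasDerivAt (fun s => φ (Φ s u)) d 0)
    {ε : ℝ} {u : X} (hu : ∀ s, |s| < ε → Φ s u ∈ W) :
    StrictMonoOn (fun s => φ (Φ s u)) (Ioo (-ε) ε) ∧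
      ContinuousOn (fun s => φ (Φ s u)) (Ioo (-ε) ε) := by
  have hd : ∀ s ∈ Ioo (-ε) ε, ∃ d > 0, HasDerivAt (fun s => φ (Φ s u)) d s := by
    intro s hs
    obtain ⟨d, hd, h⟩ := hder _ (hu s (abs_lt.2 hs))
    refine ⟨d, hd, ?_⟩
    -- The derivative is assumed only at time `0`; the flow law transports it to any time at which
    -- the orbit is in `W`.
    have h1 : HasDerivAt (fun r => φ (Φ (r - s) (Φ s u))) d s :=
      HasDerivAt.comp_sub_const s s (by simpa using h)
    simpa [← Φ.map_add] using h1
  have hc : ContinuousOn (fun s => φ (Φ s u)) (Ioo (-ε) ε) := fun s hs => by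
    obtain ⟨d, -, h⟩ := hd s hs
    exact h.continuousAt.continuousWithinAt
  refine ⟨strictMonoOn_of_deriv_pos (convex_Ioo _ _) hc fun s hs => ?_, hc⟩
  rw [interior_Ioo] at hs
  obtain ⟨d, hd, h⟩ := hd s hs
  rwa [h.deriv]

theorem flow_sep (hW : W ∈ 𝓝 v₀) (hA : ∀ u ∈ W, u ∈ A ↔ φ u = 0)
    (hder : ∀ u ∈ W, ∃ d > 0, HasDerivAt (fun s => φ (Φ s u)) d 0) :
    ∃ ε > 0, ∀ᶠ u in 𝓝 v₀, ∀ s s', |s| < ε → |s'| < ε → Φ s u ∈ A → Φ s' u ∈ A → s = s' := by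
  obtain ⟨ε, hε, H⟩ := exists_flow_mem (Φ := Φ) hW
  refine ⟨ε, hε, ?_⟩
  filter_upwards [H] with u hu s s' hs hs' h h'
  refine (strictMonoOn_flow hder hu).1.injOn (abs_lt.1 hs) (abs_lt.1 hs') ?_
  rw [(hA _ (hu s hs)).1 h, (hA _ (hu s' hs')).1 h']

/-- Along the orbit of `v₀`, `φ` is negative shortly before and positive shortly after time `0`.
Both signs persist for nearby orbits, and the intermediate value theorem gives a zero. -/
theorem flow_hit (hW : W ∈ 𝓝 v₀) (hA : ∀ u ∈ W, u ∈ A ↔ φ u = 0)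
    (hder : ∀ u ∈ W, ∃ d > 0, HasDerivAt (fun s => φ (Φ s u)) d 0)
    (hφ : ∀ u ∈ W, ContinuousAt φ u) (hv₀ : v₀ ∈ A) {ε : ℝ} (hε : 0 < ε) :
    ∀ᶠ u in 𝓝 v₀, ∃ s, |s| < ε ∧ Φ s u ∈ A := by
  obtain ⟨ε', hε', H⟩ := exists_flow_mem (Φ := Φ) hW
  set r := min ε ε' / 2 with hr
  have hr0 : 0 < r := by positivity
  have hr1 : r < ε := by have := min_le_left ε ε'; linarith
  have hr2 : r < ε' := by have := min_le_right ε ε'; linarith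
  have hv := H.self_of_nhds
  have hmono := (strictMonoOn_flow hder hv).1
  have h0 : φ (Φ 0 v₀) = 0 := by
    rw [Φ.map_zero_apply]; exact (hA _ (mem_of_mem_nhds hW)).1 hv₀
  have hpos : 0 < φ (Φ r v₀) := by
    rw [← h0]; exact hmono ⟨by linarith, by linarith⟩ ⟨by linarith, by linarith⟩ hr0
  have hneg : φ (Φ (-r) v₀) < 0 := by
    rw [← h0]
    exact hmono ⟨by linarith, by linarith⟩ ⟨by linarith, by linarith⟩ (neg_lt_zero.2 hr0)
  have hcont : ∀ s, |s| < ε' → ContinuousAt (fun u => φ (Φ s u)) v₀ := fun s hs =>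
    ContinuousAt.comp (g := φ) (f := fun u => Φ s u) (hφ _ (hv s hs))
      (Φ.continuous continuous_const continuous_id).continuousAt
  filter_upwards [H, (hcont r (by rwa [abs_of_pos hr0])).eventually (lt_mem_nhds hpos),
    (hcont (-r) (by rwa [abs_neg, abs_of_pos hr0])).eventually (gt_mem_nhds hneg)] with u hu h1 h2
  have hsub : Icc (-r) r ⊆ Ioo (-ε') ε' := Icc_subset_Ioo (by linarith) hr2
  obtain ⟨s, hs, hs0⟩ := intermediate_value_Icc (by linarith : -r ≤ r)
    ((strictMonoOn_flow hder hu).2.mono hsub) ⟨h2.le, h1.le⟩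
  exact ⟨s, abs_lt.2 ⟨by linarith [hs.1], by linarith [hs.2]⟩,
    (hA _ (hu s (abs_lt.2 (hsub hs)))).2 hs0⟩

end FlowBox

/-! ### Transversality of the geodesic flow to the annulus -/

section Surface

variable {M : Type*} [TopologicalSpace M] [ChartedSpace Plane M] [IsManifold (𝓡 2) ∞ M]
  [RiemannianBundle (fun x : M => TangentSpace (𝓡 2) x)]
  [IsContMDiffRiemannianBundle (𝓡 2) ∞ Plane (fun x : M => TangentSpace (𝓡 2) x)]

variable {𝒜 : Set (OpenPartialHomeomorph M Plane)} {γ : ℝ → M} {ℓ : ℝ}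
  {Φ : Flow ℝ (UnitTangent M)}

theorem IsGeodesicFlow.tangentLift_orbit (hΦ : IsGeodesicFlow Φ) (v : UnitTangent M) (t : ℝ) :
    tangentLift (fun s => (Φ s v).1.proj) t = (Φ t v).1 :=
  ((hΦ v).2 t).symm

theorem IsGeodesicFlow.flow_eq [T2Space M] (hΦ : IsGeodesicFlow Φ) {σ : ℝ → M} (hσ : IsGeodesic σ)
    {v : UnitTangent M} {s : ℝ} (hv : v.1 = tangentLift σ s) (t : ℝ) :
    (Φ t v).1 = tangentLift σ (t + s) := by
  -- Shifting the starting point by `-s` makes the orbit and `σ` tangent at the same time `s`, as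
  -- the uniqueness theorem requires.
  have h1 : tangentLift (fun r => (Φ r (Φ (-s) v)).1.proj) s = tangentLift σ s := by
    rw [hΦ.tangentLift_orbit, ← hv, ← Φ.map_add, add_neg_cancel, Φ.map_zero_apply]
  have h2 := (hΦ (Φ (-s) v)).1.tangentLift_eq hσ h1
  rw [← h2, hΦ.tangentLift_orbit, ← Φ.map_add, add_neg_cancel_right]

theorem IsGeodesicFlow.flow_eq_neg [T2Space M] (hΦ : IsGeodesicFlow Φ) {σ : ℝ → M}
    (hσ : IsGeodesic σ) {v : UnitTangent M} {s : ℝ} (hv : v.1 = ⟨σ s, -velocity σ s⟩) (t : ℝ) :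
    (Φ t v).1 = ⟨σ (s - t), -velocity σ (s - t)⟩ := by
  have hv' : v.1 = tangentLift (fun r => σ (-r)) (-s) := by
    rw [tangentLift_comp_neg hσ.smooth, neg_neg, hv]
  rw [hΦ.flow_eq hσ.comp_neg hv' t, tangentLift_comp_neg hσ.smooth,
    show -(t + -s) = s - t by ring]

/-- Near a vector of the annulus, the annulus is the zero set of a function which increases along
the orbits of the geodesic flow. -/
theorem exists_crossing_function [T2Space M] (h𝒜 : IsOrientedAtlas 𝒜)
    (hγ : IsSimpleClosedGeodesic γ ℓ) (hΦ : IsGeodesicFlow Φ) {v₀ : UnitTangent M}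
    (hv₀ : v₀ ∈ annulus 𝒜 γ) : ∃ W ∈ 𝓝 v₀, ∃ φ : UnitTangent M → ℝ,
      (∀ u ∈ W, u ∈ annulus 𝒜 γ ↔ φ u = 0) ∧
      (∀ u ∈ W, ∃ d > 0, HasDerivAt (fun s => φ (Φ s u)) d 0) ∧ ∀ u ∈ W, ContinuousAt φ u := by
  obtain ⟨t₀, ht⟩ := annulus_subset_unitAlong hv₀
  obtain ⟨e, he, hs⟩ := h𝒜.covers v₀.1.proj
  have heM := h𝒜.1 he
  obtain ⟨β, hβ1, hβ0, hβ⟩ := exists_local_parameter hγ.geodesic.smooth.continuous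
    hγ.length_pos hγ.periodic hγ.simple t₀
  have hside := (mem_annulus_iff h𝒜 hγ he ht hs).1 hv₀
  have hγs : γ t₀ ∈ e.source := ht ▸ hs
  have hcd : ContDiffAt ℝ 1 (fun t => e (γ t)) t₀ := by
    have h1 := (contMDiffAt_of_mem_maximalAtlas heM hγs).comp t₀ (hγ.geodesic.smooth t₀)
    exact (contMDiffAt_iff_contDiffAt.1 h1).of_le (mod_cast le_top)
  have ha := hasDerivAt_chart_comp heM hγ.geodesic.smooth hγs
  have ha0 : coordVec e (tangentLift γ t₀) ≠ 0 := by
    intro h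
    rw [sideFun, h] at hside
    simp [cross] at hside
  obtain ⟨f, hf, hf', hfγ, hfU⟩ := exists_local_defining_function hcd ha ha0
  rw [ht] at hf hf' hfU
  have hπ : ContinuousAt (fun v : UnitTangent M => v.1.proj) v₀ :=
    continuous_unitTangent_proj.continuousAt
  have heπ : ContinuousAt (fun v : UnitTangent M => e v.1.proj) v₀ :=
    ContinuousAt.comp (f := fun v : UnitTangent M => v.1.proj) (e.continuousAt hs) hπ
  have hcoord : ContinuousAt (fun v : UnitTangent M => coordVec e v.1) v₀ :=
    ContinuousAt.comp (f := Subtype.val) ((continuousOn_coordVec heM).continuousAt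
      ((e.open_source.preimage
        (FiberBundle.continuous_proj Plane (TangentSpace (𝓡 2)))).mem_nhds hs))
      continuous_subtype_val.continuousAt
  have hev1 : ∀ᶠ v : UnitTangent M in 𝓝 v₀, v.1.proj ∈ e.source :=
    hπ.preimage_mem_nhds (e.open_source.mem_nhds hs)
  have hev2 : ∀ᶠ v : UnitTangent M in 𝓝 v₀, ContDiffAt ℝ 1 f (e v.1.proj) :=
    heπ.eventually (hf.eventually (by simp))
  -- At `v₀` this derivative is the oriented area of the velocity of `γ` and `v₀`, positive because
  -- `v₀` points to the left.
  have hev3 : ∀ᶠ v : UnitTangent M in 𝓝 v₀, 0 < fderiv ℝ f (e v.1.proj) (coordVec e v.1) := by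
    have h1 : ContinuousAt (fderiv ℝ f) (e v₀.1.proj) :=
      (hf.fderiv_right (m := 0) (by simp)).continuousAt
    have h2 : ContinuousAt (fun v : UnitTangent M => fderiv ℝ f (e v.1.proj) (coordVec e v.1)) v₀ :=
      (ContinuousAt.comp (f := fun v : UnitTangent M => e v.1.proj) h1 heπ).clm_apply hcoord
    refine h2.eventually (lt_mem_nhds ?_)
    beta_reduce
    rw [hf']
    exact hside
  have hev4 : ∀ᶠ v : UnitTangent M in 𝓝 v₀, v ∈ unitAlong γ → f (e (γ (β v.1.proj))) = 0 := by
    have h1 : Tendsto (fun v : UnitTangent M => β v.1.proj) (𝓝[unitAlong γ] v₀) (𝓝 t₀) :=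
      hβ.comp (ht ▸ tendsto_proj v₀)
    exact eventually_nhdsWithin_iff.1 (h1.eventually hfγ)
  -- The parameter is required to stay in the preimage of the chart domain, so that equality of
  -- coordinates gives equality of points.
  have hev5 : ∀ᶠ v : UnitTangent M in 𝓝 v₀, f (e v.1.proj) = 0 →
      ∃ t ∈ γ ⁻¹' e.source, e (γ t) = e v.1.proj :=
    heπ.eventually (hfU _ (hγ.geodesic.smooth.continuous.continuousAt.preimage_mem_nhds
      (e.open_source.mem_nhds hγs)))
  refine ⟨_, hev1.and (hev2.and (hev3.and (hev4.and (hev5.and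
    (eventually_mem_annulus h𝒜 hγ hv₀))))), fun v => f (e v.1.proj), ?_, ?_, ?_⟩
  · rintro v ⟨h1, h2, h3, h4, h5, h6⟩
    constructor
    · intro hv
      have hvT := annulus_subset_unitAlong hv
      rw [← h4 hvT, hβ1 _ hvT]
    · intro h0
      obtain ⟨t, hts, h⟩ := h5 h0
      exact h6 ⟨t, e.injOn hts h1 h⟩
  · rintro v ⟨h1, h2, h3, -⟩
    refine ⟨_, h3, ?_⟩
    have hd := hasDerivAt_chart_comp heM (hΦ v).1.smooth (t := 0)
      (show (Φ 0 v).1.proj ∈ e.source by rwa [Φ.map_zero_apply])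
    rw [hΦ.tangentLift_orbit, Φ.map_zero_apply] at hd
    have hf0 : HasFDerivAt f (fderiv ℝ f (e v.1.proj)) (e (Φ 0 v).1.proj) := by
      rw [Φ.map_zero_apply]; exact (h2.differentiableAt one_ne_zero).hasFDerivAt
    exact hf0.comp_hasDerivAt (0 : ℝ) hd
  · rintro v ⟨h1, h2, -⟩
    exact ContinuousAt.comp (f := fun v : UnitTangent M => e v.1.proj) h2.continuousAt
      (ContinuousAt.comp (f := fun v : UnitTangent M => v.1.proj) (e.continuousAt h1)
        continuous_unitTangent_proj.continuousAt)

end Surface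

/-! ### The annulus as the sphere without its poles, and the conclusion -/

section Surface

variable {M : Type*} [TopologicalSpace M] [ChartedSpace Plane M] [IsManifold (𝓡 2) ∞ M]
  [RiemannianBundle (fun x : M => TangentSpace (𝓡 2) x)]
  [IsContMDiffRiemannianBundle (𝓡 2) ∞ Plane (fun x : M => TangentSpace (𝓡 2) x)]

variable {𝒜 : Set (OpenPartialHomeomorph M Plane)} {γ : ℝ → M} {ℓ : ℝ}
  {Φ : Flow ℝ (UnitTangent M)}

theorem IsGeodesic.velocity_ne_zero {σ : ℝ → M} (hσ : IsGeodesic σ) (t : ℝ) :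
    velocity σ t ≠ 0 := fun h => by
  have := hσ.unit_speed t
  rw [h, norm_zero] at this
  exact zero_ne_one this

theorem polarMap_eq_northPole (hγ : IsSimpleClosedGeodesic γ ℓ) {v : UnitTangent M} {t : ℝ}
    (h : v.1 = tangentLift γ t) : polarMap γ ℓ v = northPole := by
  rw [polarMap_eq hγ h, InnerProductGeometry.angle_self (hγ.geodesic.velocity_ne_zero t),
    spherePoint_zero]

theorem polarMap_eq_southPole (hγ : IsSimpleClosedGeodesic γ ℓ) {v : UnitTangent M} {t : ℝ}
    (h : v.1 = ⟨γ t, -velocity γ t⟩) : polarMap γ ℓ v = southPole := by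
  rw [polarMap_eq hγ h,
    InnerProductGeometry.angle_self_neg_of_nonzero (hγ.geodesic.velocity_ne_zero t),
    spherePoint_pi]

theorem IsPositivePair.angle_mem_Ioo {x : M} {u w : TangentSpace (𝓡 2) x}
    (h : IsPositivePair 𝒜 x u w) : InnerProductGeometry.angle u w ∈ Ioo 0 Real.pi := by
  obtain ⟨e, -, -, h⟩ := h
  have hsmul : ∀ r : ℝ, w ≠ r • u := by
    rintro r rfl
    have h1 : mfderiv (𝓡 2) (𝓡 2) e x (r • u) = r • mfderiv (𝓡 2) (𝓡 2) e x u :=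
      map_smul (mfderiv (𝓡 2) (𝓡 2) e x) r u
    have h2 : 0 < cross (mfderiv (𝓡 2) (𝓡 2) e x u : Plane)
        (mfderiv (𝓡 2) (𝓡 2) e x (r • u) : Plane) := h
    rw [h1] at h2
    have h3 : ∀ a : Plane, cross a (r • a) = 0 := fun a => by simp [cross]; ring
    exact h2.ne' (h3 _)
  refine ⟨(InnerProductGeometry.angle_nonneg u w).lt_of_ne fun h0 => ?_,
    (InnerProductGeometry.angle_le_pi u w).lt_of_ne fun h0 => ?_⟩
  · obtain ⟨-, r, -, hr⟩ := InnerProductGeometry.angle_eq_zero_iff.1 h0.symm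
    exact hsmul r hr
  · obtain ⟨-, r, -, hr⟩ := InnerProductGeometry.angle_eq_pi_iff.1 h0
    exact hsmul r hr

theorem mem_annulus_iff_polarMap (hγ : IsSimpleClosedGeodesic γ ℓ) (v : UnitTangent M) :
    v ∈ annulus 𝒜 γ ↔
      v ∈ closedAnnulus 𝒜 γ ∧ polarMap γ ℓ v ≠ northPole ∧ polarMap γ ℓ v ≠ southPole := by
  constructor
  · intro hv
    refine ⟨.inl hv, ?_⟩
    obtain ⟨t, w, h, hpos⟩ := hv
    have hα := hpos.angle_mem_Ioo
    rw [polarMap_eq hγ h]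
    exact ⟨fun h0 => hα.1.ne' (spherePoint_eq_north (Ioo_subset_Icc_self hα) h0),
      fun h0 => hα.2.ne (spherePoint_eq_south (Ioo_subset_Icc_self hα) h0)⟩
  · rintro ⟨hv | ⟨t, h | h⟩, hN, hS⟩
    · exact hv
    · exact absurd (polarMap_eq_northPole hγ h) hN
    · exact absurd (polarMap_eq_southPole hγ h) hS

theorem eq_tangentLift_of_polarMap_eq_northPole (hγ : IsSimpleClosedGeodesic γ ℓ)
    {v : UnitTangent M} (hv : v ∈ closedAnnulus 𝒜 γ) (hN : polarMap γ ℓ v = northPole) :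
    ∃ t, v.1 = tangentLift γ t := by
  rcases hv with hv | ⟨t, h | h⟩
  · exact absurd hN ((mem_annulus_iff_polarMap hγ v).1 hv).2.1
  · exact ⟨t, h⟩
  · exact absurd (hN.symm.trans (polarMap_eq_southPole hγ h)) northPole_ne_southPole

theorem eq_neg_of_polarMap_eq_southPole (hγ : IsSimpleClosedGeodesic γ ℓ)
    {v : UnitTangent M} (hv : v ∈ closedAnnulus 𝒜 γ) (hS : polarMap γ ℓ v = southPole) :
    ∃ t, v.1 = ⟨γ t, -velocity γ t⟩ := by
  rcases hv with hv | ⟨t, h | h⟩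
  · exact absurd hS ((mem_annulus_iff_polarMap hγ v).1 hv).2.2
  · exact absurd ((polarMap_eq_northPole hγ h).symm.trans hS) northPole_ne_southPole
  · exact ⟨t, h⟩

/-- The longitude determines the base point, the colatitude determines the inner product with the
velocity of `γ`, and the left side selects one of the unit vectors with this inner product. -/
theorem injOn_polarMap (h𝒜 : IsOrientedAtlas 𝒜) (hγ : IsSimpleClosedGeodesic γ ℓ) :
    InjOn (polarMap γ ℓ) (annulus 𝒜 γ) := by
  rintro v ⟨t, w, h, hpos⟩ v' ⟨t', w', h', hpos'⟩ heq
  rw [polarMap_eq hγ h, polarMap_eq hγ h'] at heq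
  obtain ⟨hα, k, hk⟩ := spherePoint_inj hpos.angle_mem_Ioo hpos'.angle_mem_Ioo heq
  have hℓ := hγ.length_pos.ne'
  have hpi := Real.pi_pos.ne'
  have ht : t' = t + k * ℓ := by
    field_simp at hk
    nlinarith [hk]
  have hγt : γ t = γ t' := by rw [ht]; exact (hγ.periodic.int_mul k t).symm
  obtain ⟨w₁, hw₁⟩ := exists_eq_mk (v := v'.1) (x := γ t)
    (hγt.trans (congrArg TotalSpace.proj h').symm)
  have hlift := hγ.tangentLift_eq_of_eq hγt
  have hw₁' := hw₁.symm.trans h'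
  rw [← angle_eq_of_totalSpace_eq hlift hw₁'] at hα
  obtain ⟨e, he, hs⟩ := h𝒜.covers (γ t)
  have hpos₁ : 0 < sideFun e γ t v' := (mem_annulus_iff h𝒜 hγ he
    (show γ t = v'.1.proj by rw [hw₁]) (by rw [hw₁]; exact hs)).1 ⟨t', w', h', hpos'⟩
  have hpos₀ : 0 < sideFun e γ t v := (mem_annulus_iff h𝒜 hγ he
    (show γ t = v.1.proj by rw [h]) (by rw [h]; exact hs)).1 ⟨t, w, h, hpos⟩
  rw [sideFun, hw₁] at hpos₁
  rw [sideFun, h] at hpos₀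
  have hn : ‖w‖ = 1 := by have := v.2; rw [h] at this; exact this
  have hn₁ : ‖w₁‖ = 1 := by have := v'.2; rw [hw₁] at this; exact this
  have hu := hγ.geodesic.unit_speed t
  have hin : inner ℝ (velocity γ t) w = inner ℝ (velocity γ t) w₁ := by
    rw [← InnerProductGeometry.cos_angle_mul_norm_mul_norm, hα, hn, ← hn₁,
      InnerProductGeometry.cos_angle_mul_norm_mul_norm]
  have := eq_of_inner_eq_of_cross_pos (L := (mfderiv (𝓡 2) (𝓡 2) e (γ t)).toLinearMap)
    (injective_mfderiv_chart (h𝒜.1 he) hs) hu hn hn₁ hin hpos₀ hpos₁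
  exact Subtype.ext (by rw [h, hw₁, this])

theorem surjective_mfderiv_chart {e : OpenPartialHomeomorph M Plane}
    (he : e ∈ IsManifold.maximalAtlas (𝓡 2) ∞ M) {x : M} (hx : x ∈ e.source) :
    Function.Surjective (mfderiv (𝓡 2) (𝓡 2) e x) := by
  have h : e.MDifferentiable (𝓡 2) (𝓡 2) :=
    ⟨(contMDiffOn_of_mem_maximalAtlas he).mdifferentiableOn (by simp),
      (contMDiffOn_symm_of_mem_maximalAtlas he).mdifferentiableOn (by simp)⟩
  exact h.mfderiv_surjective hx

theorem exists_polarMap_eq (h𝒜 : IsOrientedAtlas 𝒜) (hγ : IsSimpleClosedGeodesic γ ℓ) (y : S2) :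
    ∃ v ∈ closedAnnulus 𝒜 γ, polarMap γ ℓ v = y := by
  obtain ⟨α, hα, β, -, rfl⟩ := exists_spherePoint y
  have hu := fun t => hγ.geodesic.unit_speed t
  rcases hα.1.eq_or_lt with rfl | h0
  · exact ⟨⟨tangentLift γ 0, hu 0⟩, .inr ⟨0, .inl rfl⟩, by
      rw [polarMap_eq_northPole hγ (t := 0) rfl, spherePoint_zero]⟩
  rcases hα.2.eq_or_lt with rfl | hpi
  · exact ⟨⟨⟨γ 0, -velocity γ 0⟩, by rw [norm_neg]; exact hu 0⟩, .inr ⟨0, .inr rfl⟩, by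
      rw [polarMap_eq_southPole hγ (t := 0) rfl, spherePoint_pi]⟩
  -- The parameter whose longitude `2 π t / ℓ` is `β`.
  set t := ℓ * β / (2 * Real.pi) with ht
  obtain ⟨e, he, hs⟩ := h𝒜.covers (γ t)
  obtain ⟨w, hw, hin, hpos⟩ := exists_unit_inner_eq_cross_pos
    (L := (mfderiv (𝓡 2) (𝓡 2) e (γ t)).toLinearMap)
    (injective_mfderiv_chart (h𝒜.1 he) hs) (surjective_mfderiv_chart (h𝒜.1 he) hs) (hu t)
    (c := Real.cos α)
    (by rw [← Real.cos_pi]; exact Real.strictAntiOn_cos hα ⟨Real.pi_pos.le, le_rfl⟩ hpi)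
    (by rw [← Real.cos_zero]; exact Real.strictAntiOn_cos ⟨le_rfl, Real.pi_pos.le⟩ hα h0)
  refine ⟨⟨⟨γ t, w⟩, hw⟩, .inl ⟨t, w, rfl, (isPositivePair_iff h𝒜 he hs _ _).2 hpos⟩, ?_⟩
  rw [polarMap_eq hγ rfl, InnerProductGeometry.angle, hin, hu t, hw, mul_one, div_one,
    Real.arccos_cos hα.1 hα.2]
  congr 1
  have hℓ := hγ.length_pos.ne'
  have hpi := Real.pi_pos.ne'
  rw [ht]
  field_simp

theorem northPole_invariant [T2Space M] (hγ : IsSimpleClosedGeodesic γ ℓ) (hΦ : IsGeodesicFlow Φ)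
    (v : UnitTangent M) (hv : v ∈ closedAnnulus 𝒜 γ) (hN : polarMap γ ℓ v = northPole) (t : ℝ) :
    Φ t v ∈ closedAnnulus 𝒜 γ ∧ polarMap γ ℓ (Φ t v) = northPole := by
  obtain ⟨s, hs⟩ := eq_tangentLift_of_polarMap_eq_northPole hγ hv hN
  have h := hΦ.flow_eq hγ.geodesic hs t
  exact ⟨.inr ⟨_, .inl h⟩, polarMap_eq_northPole hγ h⟩

theorem southPole_invariant [T2Space M] (hγ : IsSimpleClosedGeodesic γ ℓ) (hΦ : IsGeodesicFlow Φ)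
    (v : UnitTangent M) (hv : v ∈ closedAnnulus 𝒜 γ) (hS : polarMap γ ℓ v = southPole) (t : ℝ) :
    Φ t v ∈ closedAnnulus 𝒜 γ ∧ polarMap γ ℓ (Φ t v) = southPole := by
  obtain ⟨s, hs⟩ := eq_neg_of_polarMap_eq_southPole hγ hv hS
  have h := hΦ.flow_eq_neg hγ.geodesic hs t
  exact ⟨.inr ⟨_, .inr h⟩, polarMap_eq_southPole hγ h⟩

/-- The annulus of the vectors pointing to the left of a simple closed geodesic is a polar section
of an equicontinuous geodesic flow. -/
theorem exists_polarSection [T2Space M] [CompactSpace M] (h𝒜 : IsOrientedAtlas 𝒜)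
    (hγ : IsSimpleClosedGeodesic γ ℓ) (hΦ : IsGeodesicFlow Φ) (hequi : IsEquicontinuousFlow Φ) :
    IsOpenEmbedding (fun v : annulus 𝒜 γ => polarMap γ ℓ v) ∧
    range (fun v : annulus 𝒜 γ => polarMap γ ℓ v) = {northPole, southPole}ᶜ ∧
    ∃ (F : annulus 𝒜 γ → annulus 𝒜 γ) (F' : S2 ≃ₜ S2), IsFirstReturnMap Φ (annulus 𝒜 γ) F ∧
      (∀ v : annulus 𝒜 γ, F' (polarMap γ ℓ v) = polarMap γ ℓ (F v)) ∧
      F' northPole = northPole ∧ F' southPole = southPole ∧ IsRecurrent F' := by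
  obtain ⟨m, hm, H⟩ := hequi
  -- The metric is adjusted so that its topology is definitionally that of `SM`, for which the flow
  -- and the section are already defined.
  let _ : MetricSpace (UnitTangent M) := m.replaceTopology hm.symm
  have hsec : PolarSection Φ (annulus 𝒜 γ) (closedAnnulus 𝒜 γ) (polarMap γ ℓ) northPole
      southPole :=
    { equi := H
      isClosed := isClosed_closedAnnulus h𝒜 hγ
      cont := (continuousOn_polarMap hγ).mono closedAnnulus_subset_unitAlong
      surj := exists_polarMap_eq h𝒜 hγ
      mem_iff := mem_annulus_iff_polarMap hγ
      inj := injOn_polarMap h𝒜 hγ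
      ne := northPole_ne_southPole
      north := northPole_invariant hγ hΦ
      south := southPole_invariant hγ hΦ
      hit := fun v hv ε hε => by
        obtain ⟨W, hW, φ, h1, h2, h3⟩ := exists_crossing_function h𝒜 hγ hΦ hv
        exact flow_hit hW h1 h2 h3 hv hε
      sep := fun v hv => by
        obtain ⟨W, hW, φ, h1, h2, -⟩ := exists_crossing_function h𝒜 hγ hΦ hv
        exact flow_sep hW h1 h2
      core := fun U hU V hV => exists_sphere_core hU hV }
  exact ⟨hsec.isOpenEmbedding.1, hsec.isOpenEmbedding.2, hsec.exists_returnMap⟩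

end Surface

end GeodesicReturn

end

theorem proposition3p1 {M : Type*} [TopologicalSpace M] [T2Space M] [CompactSpace M]
    [ChartedSpace GeodesicReturn.Plane M] [IsManifold (𝓡 2) ∞ M]
    [RiemannianBundle (fun x : M => TangentSpace (𝓡 2) x)]
    [IsContMDiffRiemannianBundle (𝓡 2) ∞ GeodesicReturn.Plane
      (fun x : M => TangentSpace (𝓡 2) x)]
    (𝒜 : Set (OpenPartialHomeomorph M GeodesicReturn.Plane))
    (h𝒜 : GeodesicReturn.IsOrientedAtlas 𝒜)
    (Φ : Flow ℝ (GeodesicReturn.UnitTangent M)) (hΦ : GeodesicReturn.IsGeodesicFlow Φ)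
    (hequi : GeodesicReturn.IsEquicontinuousFlow Φ)
    (γ : ℝ → M) (ℓ : ℝ) (hγ : GeodesicReturn.IsSimpleClosedGeodesic γ ℓ) :
    -- `S²` is the two-point compactification of the annulus
    IsOpenEmbedding (GeodesicReturn.annulusToSphere 𝒜 γ ℓ) ∧
    range (GeodesicReturn.annulusToSphere 𝒜 γ ℓ) =
      {GeodesicReturn.northPole, GeodesicReturn.southPole}ᶜ ∧
    -- the return map exists, and its extension to `S²` is a recurrent homeomorphism
    ∃ (F : GeodesicReturn.annulus 𝒜 γ → GeodesicReturn.annulus 𝒜 γ)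
      (F' : GeodesicReturn.S2 ≃ₜ GeodesicReturn.S2),
      GeodesicReturn.IsFirstReturnMap Φ (GeodesicReturn.annulus 𝒜 γ) F ∧
      (∀ v, F' (GeodesicReturn.annulusToSphere 𝒜 γ ℓ v) =
        GeodesicReturn.annulusToSphere 𝒜 γ ℓ (F v)) ∧
      F' GeodesicReturn.northPole = GeodesicReturn.northPole ∧
      F' GeodesicReturn.southPole = GeodesicReturn.southPole ∧
      GeodesicReturn.IsRecurrent F' := by
  have h := GeodesicReturn.annulusToSphere_eq_polarMap (𝒜 := 𝒜) hγ
  rw [funext h]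
  exact GeodesicReturn.exists_polarSection h𝒜 hγ hΦ hequi
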